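/- Spaces are topological spaces considered up to homotopy equivalence, and all pullbacks are homotopy pullbacks: $X\times_Z Y$ is the space of triples $(x,\omega,y)$ with $\omega$ a path in $Z$ from $f(x)$ to $g(y)$, and a square commuting up to homotopy is a pullback if, for some such homotopy, its comparison map to this space is a homotopy equivalence. The free loop space $\Lambda X$ is the pullback of the diagonal $\Delta\colon X\to X\times X$ along itself, with evaluation $\Lambda X\to X$ given by the first projection. Let $p\colon E\to B$ be a map to a path-connected space $B$ with base point $b$, let $\Omega B$ be the space of loops at $b$, with the map $\Omega B\to\Lambda B$ sending $\gamma$ to the pair of paths $(\gamma,\mathrm{const}_b)$ from $b$ to $b$, and let $F$ be the homotopy fibre of $p$ over $b$, that is, the space of pairs $(e,\omega)$ with $\omega$ a path from $p(e)$ to $b$. Loops act on $F$ by $(e,\omega).\gamma=(e,\omega\cdot\gamma)$. The incidence correspondence $\mathbb I$ is the pullback of $\Lambda p\colon \Lambda E\to\Lambda B$ along $\Omega B\to\Lambda B$; it has a projection to $\Omega B$ and, using evaluation $\Lambda E\to E$, $\Lambda B\to B$, a projection to $F$. For $\gamma\in\Omega B$, the space $F^\gamma$ is the homotopy fibre of $\mathbb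 I\to\Omega B$ over $\gamma$. Then: 1. $\Omega B$ is the homotopy fibre of $\Lambda B\to B$ over $b$. 2. The canonical map $F\times_E F\to F\times\Omega B$, whose components are the first projection and the map $F\times_E F\to \{b\}\times_B\{b\}=\Omega B$ induced by $p$, i.e. $\bigl((e,\omega),\varepsilon,(e',\omega')\bigr)\mapsto \omega^{-1}\cdot p(\varepsilon)\cdot\omega'$, is a homotopy equivalence; under it the two projections $F\times_E F\to F\times F$ become, up to homotopy, the shear map $F\times\Omega B\to F\times F$, $(x,\gamma)\mapsto(x,x.\gamma)$. 3. The square with upper left corner $\mathbb I$ formed by the projections $\mathbb I\to F$ and $\mathbb I\to F\times\Omega B$, the diagonal $F\to F\times F$ and the shear map $F\times\Omega B\to F\times F$ is a homotopy pullback. 4. There is a homotopy equivalence $\Psi$ from $\mathbb I$ to the space of triples $(x,\gamma,\pi)$ with $x\in F$, $\gamma\in\Omega B$ and $\pi$ a path in $F$ from $x.\gamma$ to $x$, compatible up to homotopy with the maps to $F\times\Omega B$. For every $\gamma\in\Omega B$ there is a homotopy equivalence from $F^\gamma$ to the space of homotopy fixpoints of $\gamma$, i.e. of pairs $(x,\pi)$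 with $x\in F$ and $\pi$ a path in $F$ from $x.\gamma$ to $x$, such that the square formed with $F^\gamma\to\mathbb I$, $(x,\pi)\mapsto(x,\gamma,\pi)$ and $\Psi$ commutes up to homotopy. -/

import Mathlib

open scoped unitInterval

noncomputable section

namespace FixInt

open ContinuousMap

variable {X Y Z P X' Y' Z' : Type*}
  [TopologicalSpace X] [TopologicalSpace Y] [TopologicalSpace Z] [TopologicalSpace P]
  [TopologicalSpace X'] [TopologicalSpace Y'] [TopologicalSpace Z']

/-! ### Homotopy pullbacks of spaces -/

/-- A continuous map is a homotopy equivalence. -/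
def IsHomotopyEquiv (f : C(X, Y)) : Prop :=
  ∃ e : ContinuousMap.HomotopyEquiv X Y, e.toFun = f

/-- The homotopy pullback of `f : X → Z` and `g : Y → Z`: triples `(x, ω, y)` where `ω` is a path
in `Z` from `f x` to `g y` (path spaces carry the compact-open topology). -/
def HPullback (f : C(X, Z)) (g : C(Y, Z)) : Type _ :=
  {w : X × C(I, Z) × Y // w.2.1 0 = f w.1 ∧ w.2.1 1 = g w.2.2}

namespace HPullback

variable {f : C(X, Z)} {g : C(Y, Z)}

instance : TopologicalSpace (HPullback f g) :=
  inferInstanceAs (TopologicalSpace {w : X × C(I, Z) × Y // w.2.1 0 = f w.1 ∧ w.2.1 1 = g w.2.2})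

/-- The projection to `X`. -/
def fst (f : C(X, Z)) (g : C(Y, Z)) : C(HPullback f g, X) :=
  ⟨fun w => w.1.1, continuous_fst.comp continuous_subtype_val⟩

/-- The projection to `Y`. -/
def snd (f : C(X, Z)) (g : C(Y, Z)) : C(HPullback f g, Y) :=
  ⟨fun w => w.1.2.2, (continuous_snd.comp continuous_snd).comp continuous_subtype_val⟩

/-- The path component of a point of the homotopy pullback. -/
def path (w : HPullback f g) : Path (f (fst f g w)) (g (snd f g w)) where
  toContinuousMap := w.1.2.1
  source' := w.2.1
  target' := w.2.2

theorem continuous_path : Continuous fun q : HPullback f g × I => path q.1 q.2 := by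
  have h : Continuous fun w : HPullback f g => w.1.2.1 :=
    (continuous_fst.comp continuous_snd).comp continuous_subtype_val
  exact continuous_eval.comp ((h.comp continuous_fst).prodMk continuous_snd)

/-- A map into the homotopy pullback given by its two components and a continuous family of
paths. -/
def mk (a : C(P, X)) (c : C(P, Y)) (γ : ∀ q, Path (f (a q)) (g (c q)))
    (hγ : Continuous fun q : P × I => γ q.1 q.2) : C(P, HPullback f g) where
  toFun q := ⟨(a q, (γ q).toContinuousMap, c q), (γ q).source, (γ q).target⟩
  continuous_toFun := by
    refine Continuous.subtype_mk (a.continuous.prodMk (Continuous.prodMk ?_ c.continuous)) _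
    exact ContinuousMap.continuous_of_continuous_uncurry _ hγ

/-- The comparison map from a homotopy commutative square to the homotopy pullback. -/
def lift (a : C(P, X)) (c : C(P, Y)) (H : Homotopy (f.comp a) (g.comp c)) :
    C(P, HPullback f g) :=
  mk a c (fun q => H.evalAt q) (by
    change Continuous fun q : P × I => H (q.2, q.1)
    fun_prop)

/-- The map of homotopy pullbacks induced by a strictly commuting map of cospans. -/
def map {f' : C(X', Z')} {g' : C(Y', Z')} (a : C(X, X')) (c : C(Y, Y')) (z : C(Z, Z'))
    (ha : f'.comp a = z.comp f) (hc : g'.comp c = z.comp g) :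
    C(HPullback f g, HPullback f' g') :=
  mk (a.comp (fst f g)) (c.comp (snd f g))
    (fun w => ((path w).map z.continuous).cast
      (DFunLike.congr_fun ha _) (DFunLike.congr_fun hc _))
    (z.continuous.comp continuous_path)

end HPullback

/-- The square with upper left corner `P` and sides `a : P → X`, `c : P → Y`, `f : X → Z`,
`g : Y → Z` is a homotopy pullback: it commutes up to a homotopy for which the comparison map to
the homotopy pullback of `f` and `g` is a homotopy equivalence. -/
def IsHomotopyPullback (a : C(P, X)) (c : C(P, Y)) (f : C(X, Z)) (g : C(Y, Z)) : Prop :=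
  ∃ H : Homotopy (f.comp a) (g.comp c), IsHomotopyEquiv (HPullback.lift a c H)

/-! ### Free loop spaces -/

/-- The diagonal. -/
def diag (X : Type*) [TopologicalSpace X] : C(X, X × X) :=
  (ContinuousMap.id X).prodMk (ContinuousMap.id X)

/-- The free loop space: the homotopy pullback of the diagonal along itself. -/
abbrev FreeLoop (X : Type*) [TopologicalSpace X] : Type _ := HPullback (diag X) (diag X)

/-- The projection of the free loop space to the space. -/
def FreeLoop.ev (X : Type*) [TopologicalSpace X] : C(FreeLoop X, X) :=
  HPullback.fst (diag X) (diag X)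

/-- The free loop space as a functor. -/
def FreeLoop.map (f : C(X, Y)) : C(FreeLoop X, FreeLoop Y) :=
  HPullback.map f f (f.prodMap f) rfl rfl

/-- The inclusion of the based loop space in the free loop space: a loop `γ` at `b` is sent to
the two points `b`, `b` and the two paths `γ`, `const b` between them. -/
def loopIncl (b : X) : C(LoopSpace X b, FreeLoop X) :=
  HPullback.mk (ContinuousMap.const _ b) (ContinuousMap.const _ b)
    (fun γ => γ.prod (Path.refl b))
    (by
      change Continuous fun q : LoopSpace X b × I => (q.1 q.2, b)
      fun_prop)

/-! ### The fibre and the shear map -/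

section Fibre

variable {E B : Type*} [TopologicalSpace E] [TopologicalSpace B]

/-- The fibre of `p : E → B` over `b`, that is, the homotopy pullback of `p` along the point `b`.
Its points are pairs `(e, ω)` with `ω` a path from `p e` to `b`. -/
abbrev Fibre (p : C(E, B)) (b : B) : Type _ := HPullback p (ContinuousMap.const Unit b)

/-- The map from the fibre to the total space. -/
def Fibre.incl (p : C(E, B)) (b : B) : C(Fibre p b, E) :=
  HPullback.fst p (ContinuousMap.const Unit b)

/-- The path from `p e` to `b` in a point `(e, ω)` of the fibre. -/
def Fibre.path {p : C(E, B)} {b : B} (x : Fibre p b) : Path (p (Fibre.incl p b x)) b :=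
  HPullback.path x

theorem Fibre.continuous_path (p : C(E, B)) (b : B) :
    Continuous fun q : Fibre p b × I => Fibre.path q.1 q.2 :=
  HPullback.continuous_path

/-- The (right) holonomy action of loops on the fibre, `((e, ω), γ) ↦ (e, ω·γ)`. -/
def act (p : C(E, B)) (b : B) : C(Fibre p b × LoopSpace B b, Fibre p b) :=
  HPullback.mk ((Fibre.incl p b).comp ContinuousMap.fst) (ContinuousMap.const _ ())
    (fun q => (Fibre.path q.1).trans q.2)
    (Path.trans_continuous_family (fun q : Fibre p b × LoopSpace B b => Fibre.path q.1)
      ((Fibre.continuous_path p b).comp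
        ((continuous_fst.comp continuous_fst).prodMk continuous_snd))
      (fun q : Fibre p b × LoopSpace B b => q.2)
      (by
        change Continuous fun q : (Fibre p b × LoopSpace B b) × I => q.1.2 q.2
        fun_prop))

/-- The shear map `(x, γ) ↦ (x, x.γ)`. -/
def shear (p : C(E, B)) (b : B) : C(Fibre p b × LoopSpace B b, Fibre p b × Fibre p b) :=
  ContinuousMap.fst.prodMk (act p b)

/-- The homotopy fibre product `F ×_E F`. -/
abbrev FibreProd (p : C(E, B)) (b : B) : Type _ := HPullback (Fibre.incl p b) (Fibre.incl p b)

/-- The canonical map `F ×_E F → {b} ×_B {b} = ΩB` of homotopy pullbacks induced by `p`: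
for `x = (e, ω)`, `x' = (e', ω')` and a path `ε` from `e` to `e'`, the point `(x, ε, x')` is sent
to the loop `ω⁻¹ · p(ε) · ω'`. -/
def FibreProd.toLoop (p : C(E, B)) (b : B) : C(FibreProd p b, LoopSpace B b) where
  toFun w := (Fibre.path (HPullback.fst _ _ w)).symm.trans
    (((HPullback.path w).map p.continuous).trans (Fibre.path (HPullback.snd _ _ w)))
  continuous_toFun := by
    refine Path.continuous_uncurry_iff.mp ?_
    refine Path.trans_continuous_family _ ?_ _ ?_
    · refine Path.symm_continuous_family _ ?_
      exact (Fibre.continuous_path p b).comp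
        (((HPullback.fst _ _).continuous.comp continuous_fst).prodMk continuous_snd)
    · refine Path.trans_continuous_family _ ?_ _ ?_
      · exact p.continuous.comp HPullback.continuous_path
      · exact (Fibre.continuous_path p b).comp
          (((HPullback.snd _ _).continuous.comp continuous_fst).prodMk continuous_snd)

/-- The two projections `F ×_E F → F × F`. -/
def FibreProd.projections (p : C(E, B)) (b : B) : C(FibreProd p b, Fibre p b × Fibre p b) :=
  (HPullback.fst _ _).prodMk (HPullback.snd _ _)

/-- The canonical map `F ×_E F → F × ΩB`: the first projection together with the map of homotopy
pullbacks induced by `p`. -/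
def FibreProd.toFibreLoop (p : C(E, B)) (b : B) : C(FibreProd p b, Fibre p b × LoopSpace B b) :=
  (HPullback.fst _ _).prodMk (FibreProd.toLoop p b)

/-! ### The incidence correspondence and fixpoint spaces -/

/-- The incidence correspondence: the homotopy pullback of `ΛE → ΛB` along `ΩB → ΛB`. -/
abbrev Incidence (p : C(E, B)) (b : B) : Type _ := HPullback (loopIncl b) (FreeLoop.map p)

/-- The projection of the incidence correspondence to `ΩB`. -/
def Incidence.toLoop (p : C(E, B)) (b : B) : C(Incidence p b, LoopSpace B b) :=
  HPullback.fst (loopIncl b) (FreeLoop.map p)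

/-- The projection of the incidence correspondence to the fibre `F`, induced by the evaluations
`ΛE → E` and `ΛB → B`. -/
def Incidence.toFibre (p : C(E, B)) (b : B) : C(Incidence p b, Fibre p b) :=
  HPullback.mk ((FreeLoop.ev E).comp (HPullback.snd (loopIncl b) (FreeLoop.map p)))
    (ContinuousMap.const _ ())
    (fun w => ((HPullback.path w).map (FreeLoop.ev B).continuous).symm)
    (Path.symm_continuous_family
      (fun w : Incidence p b => (HPullback.path w).map (FreeLoop.ev B).continuous)
      ((FreeLoop.ev B).continuous.comp HPullback.continuous_path))

/-- The resulting map from the incidence correspondence to `F × ΩB`. -/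
def Incidence.toFibreLoop (p : C(E, B)) (b : B) :
    C(Incidence p b, Fibre p b × LoopSpace B b) :=
  (Incidence.toFibre p b).prodMk (Incidence.toLoop p b)

/-- The space `F^γ`: the fibre over `γ` of the incidence correspondence over `ΩB`, that is, its
homotopy pullback along the point `γ`. -/
abbrev FixSpace (p : C(E, B)) (b : B) (γ : LoopSpace B b) : Type _ :=
  HPullback (ContinuousMap.const Unit γ) (Incidence.toLoop p b)

/-- The map from `F^γ` to the incidence correspondence. -/
def FixSpace.toIncidence (p : C(E, B)) (b : B) (γ : LoopSpace B b) :
    C(FixSpace p b γ, Incidence p b) :=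
  HPullback.snd (ContinuousMap.const Unit γ) (Incidence.toLoop p b)

/-- The space of triples `(x, γ, π)` with `x` in the fibre, `γ` a loop and `π` a path in the fibre
from `x.γ` to `x`. -/
abbrev FixTriple (p : C(E, B)) (b : B) : Type _ :=
  {t : (Fibre p b × LoopSpace B b) × C(I, Fibre p b) //
    t.2 0 = act p b (t.1.1, t.1.2) ∧ t.2 1 = t.1.1}

/-- The projection `(x, γ, π) ↦ (x, γ)`. -/
def FixTriple.toFibreLoop (p : C(E, B)) (b : B) :
    C(FixTriple p b, Fibre p b × LoopSpace B b) :=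
  ⟨fun t => t.1.1, continuous_fst.comp continuous_subtype_val⟩

/-- The space of homotopy fixpoints of the loop `γ`: pairs `(x, π)` with `x` in the fibre and `π`
a path in the fibre from `x.γ` to `x`. -/
abbrev FixPair (p : C(E, B)) (b : B) (γ : LoopSpace B b) : Type _ :=
  {t : Fibre p b × C(I, Fibre p b) // t.2 0 = act p b (t.1, γ) ∧ t.2 1 = t.1}

/-- The inclusion `(x, π) ↦ (x, γ, π)`. -/
def FixPair.toFixTriple (p : C(E, B)) (b : B) (γ : LoopSpace B b) :
    C(FixPair p b γ, FixTriple p b) where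
  toFun t := ⟨((t.1.1, γ), t.1.2), t.2⟩
  continuous_toFun := by
    refine Continuous.subtype_mk ?_ _
    exact ((continuous_fst.comp continuous_subtype_val).prodMk continuous_const).prodMk
      (continuous_snd.comp continuous_subtype_val)

end Fibre

end FixInt

end

open FixInt

open scoped unitInterval

noncomputable section

namespace FixInt

open ContinuousMap

/-! ### Constructing homotopies -/

section Tools

variable {X Y Z P : Type*}
  [TopologicalSpace X] [TopologicalSpace Y] [TopologicalSpace Z] [TopologicalSpace P]

/-! A point of the incidence correspondence and a triple `(x, γ, π)` are both a square in `B` with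
prescribed boundary, and the boundaries differ only in where `γ` sits. Read a free loop as one
closed path (`FreeLoop.circ`). A point of the incidence correspondence is then a closed path in `E`
and a square in `B` whose bottom is the image of that path, whose left and right edges are the same
path `ω`, and whose top is `γ` followed by a constant. A path in the fibre from `x.γ` to `x` is also
a closed path in `E`, since the action does not move the point of `E`, and a square with the image
at the bottom, `ω` on the right, `ω · γ` on the left and a constant top. So `γ` has to be slid
around the upper left corner. `Square.wrap` and `Square.unwrap` do this; they are mutually inverse
on the boundary, and as the square is convex, straight lines deform their composites to the identity
relative to the boundary. This gives `isHomotopyEquiv_toTriple`.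

These maps and homotopies leave `γ` unchanged, so they pass to homotopy fibres over each `γ`
(`isHomotopyEquiv_map_of_over`). The homotopy fibre of the triples is equivalent to the strict one
by dragging along the path of loops (`PathsBetween.isHomotopyEquiv_toSlice`). The space of paths
from `u y` to `v y` is the homotopy pullback of the diagonal along `(v, u)`
(`PathsBetween.isHomotopyEquiv_toHPullback`); for `u` the action and `v` the projection, `(v, u)` is
the shear map, whence the pullback square.

The statements on `ΩB` and `F ×_E F` rest on the loops `τ⁻¹ · ℓ · τ` and `ω⁻¹ · p(ε) · ω'`, with
homotopies that let `τ` or `ε` grow from a constant path. -/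

theorem homotopic_of {f g : C(X, Y)} (K : C(I × X, Y)) (h₀ : ∀ x, K (0, x) = f x)
    (h₁ : ∀ x, K (1, x) = g x) : f.Homotopic g :=
  ⟨{ toContinuousMap := K, map_zero_left := h₀, map_one_left := h₁ }⟩

theorem isHomotopyEquiv_of {f : C(X, Y)} (g : C(Y, X))
    (h₁ : (g.comp f).Homotopic (ContinuousMap.id X))
    (h₂ : (f.comp g).Homotopic (ContinuousMap.id Y)) : IsHomotopyEquiv f :=
  ⟨⟨f, g, h₁, h₂⟩, rfl⟩

theorem IsHomotopyEquiv.comp {f : C(X, Y)} {g : C(Y, Z)} (hg : IsHomotopyEquiv g)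
    (hf : IsHomotopyEquiv f) : IsHomotopyEquiv (g.comp f) := by
  obtain ⟨e, rfl⟩ := hf
  obtain ⟨e', rfl⟩ := hg
  exact ⟨e.trans e', rfl⟩

theorem extend_coe {x y : X} (γ : Path x y) (t : I) : γ.extend (t : ℝ) = γ t :=
  Path.extend_extends' γ t

-- Paths are evaluated at arbitrary real parameters, being constant outside the unit interval.
-- Reparametrisations may therefore leave the interval, which is how constant pieces of
-- concatenations are produced without case distinctions, and continuity of a homotopy reduces to
-- continuity of a real formula.
@[fun_prop]
theorem continuous_path_extend {x y : X} {u : P → Path x y} {r : P → ℝ} (hu : Continuous u)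
    (hr : Continuous r) : Continuous fun q => (u q).extend (r q) :=
  Continuous.pathExtend (Path.continuous_uncurry_iff.mpr hu) hr

/-- A continuous family of loops given by a continuous family of functions on the line. -/
def mkLoop {b : X} (G : P → ℝ → X) (hG : Continuous fun q : P × ℝ => G q.1 q.2)
    (h₀ : ∀ q, G q 0 = b) (h₁ : ∀ q, G q 1 = b) : C(P, LoopSpace X b) where
  toFun q :=
    { toFun := fun t => G q t
      continuous_toFun := hG.comp (by fun_prop : Continuous fun t : I => (q, (t : ℝ)))
      source' := by simpa using h₀ q
      target' := by simpa using h₁ q }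
  continuous_toFun := Path.continuous_uncurry_iff.mp
    (hG.comp (by fun_prop : Continuous fun q : P × I => (q.1, (q.2 : ℝ))))

namespace HPullback

variable {f : C(X, Z)} {g : C(Y, Z)}

/-- The path component of a point of the homotopy pullback, extended to the line. -/
def line (w : HPullback f g) (t : ℝ) : Z := (path w).extend t

@[fun_prop]
theorem continuous_line {u : P → HPullback f g} {r : P → ℝ} (hu : Continuous u)
    (hr : Continuous r) : Continuous fun q => line (u q) (r q) :=
  Continuous.IccExtend (f := fun q t => path (u q) t)
    (continuous_path.comp ((hu.comp continuous_fst).prodMk continuous_snd)) hr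

theorem line_of_nonpos (w : HPullback f g) {t : ℝ} (ht : t ≤ 0) : line w t = f (fst f g w) :=
  Path.extend_of_le_zero _ ht

theorem line_of_one_le (w : HPullback f g) {t : ℝ} (ht : 1 ≤ t) : line w t = g (snd f g w) :=
  Path.extend_of_one_le _ ht

@[simp]
theorem line_zero (w : HPullback f g) : line w 0 = f (fst f g w) := line_of_nonpos w le_rfl

@[simp]
theorem line_one (w : HPullback f g) : line w 1 = g (snd f g w) := line_of_one_le w le_rfl

theorem line_coe (w : HPullback f g) (t : I) : line w t = path w t := extend_coe _ _

theorem ext {w w' : HPullback f g} (h₁ : fst f g w = fst f g w') (h₂ : snd f g w = snd f g w')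
    (h : ∀ t : I, path w t = path w' t) : w = w' :=
  Subtype.ext (Prod.ext h₁ (Prod.ext (ContinuousMap.ext h) h₂))

/-- A map to the homotopy pullback given by its two components and a continuous family of
functions on the line. -/
def ofLine (a : C(P, X)) (c : C(P, Y)) (G : P → ℝ → Z)
    (hG : Continuous fun q : P × ℝ => G q.1 q.2) (h₀ : ∀ q, G q 0 = f (a q))
    (h₁ : ∀ q, G q 1 = g (c q)) : C(P, HPullback f g) :=
  mk a c
    (fun q =>
      { toFun := fun t => G q t
        continuous_toFun := hG.comp (by fun_prop : Continuous fun t : I => (q, (t : ℝ)))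
        source' := by simpa using h₀ q
        target' := by simpa using h₁ q })
    (hG.comp (by fun_prop : Continuous fun q : P × I => (q.1, (q.2 : ℝ))))

theorem line_ofLine (a : C(P, X)) (c : C(P, Y)) (G : P → ℝ → Z)
    (hG : Continuous fun q : P × ℝ => G q.1 q.2) (h₀ : ∀ q, G q 0 = f (a q))
    (h₁ : ∀ q, G q 1 = g (c q)) (q : P) {r : ℝ} (hr : r ∈ I) :
    line (ofLine a c G hG h₀ h₁ q) r = G q r :=
  line_coe _ ⟨r, hr⟩

end HPullback

end Tools

/-! ### The fibre product of the fibre with itself -/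

section Fibre

variable {E B : Type*} [TopologicalSpace E] [TopologicalSpace B]

open HPullback

theorem Fibre.line_of_nonpos {p : C(E, B)} {b : B} (x : Fibre p b) {t : ℝ} (ht : t ≤ 0) :
    line x t = p (Fibre.incl p b x) :=
  HPullback.line_of_nonpos x ht

theorem Fibre.line_of_one_le {p : C(E, B)} {b : B} (x : Fibre p b) {t : ℝ} (ht : 1 ≤ t) :
    line x t = b :=
  HPullback.line_of_one_le x ht

theorem act_line_of_le {p : C(E, B)} {b : B} (q : Fibre p b × LoopSpace B b) {t : ℝ}
    (ht : t ≤ 1 / 2) : line (act p b q) t = line q.1 (2 * t) :=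
  Path.extend_trans_of_le_half (Fibre.path q.1) q.2 ht

theorem act_line_of_ge {p : C(E, B)} {b : B} (q : Fibre p b × LoopSpace B b) {t : ℝ}
    (ht : 1 / 2 ≤ t) : line (act p b q) t = q.2.extend (2 * t - 1) :=
  Path.extend_trans_of_half_le (Fibre.path q.1) q.2 ht

namespace FibreProd

variable {p : C(E, B)} {b : B}

theorem toLoop_extend_of_le (w : FibreProd p b) {r : ℝ} (hr : r ≤ 1 / 2) :
    (toLoop p b w).extend r = line (fst _ _ w) (1 - 2 * r) := by
  change (Path.trans _ (Path.trans _ _)).extend r = _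
  rw [Path.extend_trans_of_le_half _ _ hr, Path.extend_symm_apply]
  rfl

theorem toLoop_extend_of_mem (w : FibreProd p b) {r : ℝ} (hr : 1 / 2 ≤ r) (hr' : r ≤ 3 / 4) :
    (toLoop p b w).extend r = p (line w (4 * r - 2)) := by
  change (Path.trans _ (Path.trans _ _)).extend r = _
  rw [Path.extend_trans_of_half_le _ _ hr, Path.extend_trans_of_le_half _ _ (by linarith),
    show 4 * r - 2 = 2 * (2 * r - 1) by ring]
  rfl

theorem toLoop_extend_of_ge (w : FibreProd p b) {r : ℝ} (hr : 3 / 4 ≤ r) :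
    (toLoop p b w).extend r = line (snd _ _ w) (4 * r - 3) := by
  change (Path.trans _ (Path.trans _ _)).extend r = _
  rw [Path.extend_trans_of_half_le _ _ (by linarith),
    Path.extend_trans_of_half_le _ _ (by linarith),
    show 4 * r - 3 = 2 * (2 * r - 1) - 1 by ring]
  rfl

variable (p b)

/-- The map `(x, γ) ↦ (x, const, x.γ)`. -/
def ofFibreLoop : C(Fibre p b × LoopSpace B b, FibreProd p b) :=
  ofLine ContinuousMap.fst (act p b) (fun q _ => Fibre.incl p b q.1)
    (by fun_prop) (fun _ => rfl) (fun _ => rfl)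

theorem ofFibreLoop_line (q : Fibre p b × LoopSpace B b) (t : ℝ) :
    line (ofFibreLoop p b q) t = Fibre.incl p b q.1 :=
  rfl

theorem toFibreLoop_comp_ofFibreLoop :
    ((toFibreLoop p b).comp (ofFibreLoop p b)).Homotopic (ContinuousMap.id _) := by
  refine homotopic_of (ContinuousMap.prodMk ⟨fun q => q.2.1, by fun_prop⟩
    (mkLoop (fun q t => line (act p b q.2)
        ((1 - (q.1 : ℝ)) * max (1 / 2 - t) (4 * t - 3) + q.1 * ((1 + t) / 2)))
      (by fun_prop) ?_ ?_)) ?_ ?_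
  · rintro ⟨s, x, γ⟩
    have : (1 - (s : ℝ)) * max (1 / 2 - 0) (4 * 0 - 3) + s * ((1 + 0) / 2) = 1 / 2 := by
      norm_num; ring
    simp only [this]
    rw [act_line_of_le _ le_rfl, Fibre.line_of_one_le _ (by norm_num)]
  · rintro ⟨s, x, γ⟩
    have : (1 - (s : ℝ)) * max (1 / 2 - 1) (4 * 1 - 3) + s * ((1 + 1) / 2) = 1 := by
      norm_num
    simp only [this]
    exact Fibre.line_of_one_le _ le_rfl
  · rintro ⟨x, γ⟩
    refine Prod.ext rfl (Path.ext (funext fun t => ?_))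
    change line (act p b (x, γ)) ((1 - (0 : ℝ)) * max (1 / 2 - (t : ℝ)) (4 * t - 3)
      + 0 * ((1 + t) / 2)) = (toLoop p b (ofFibreLoop p b (x, γ))) t
    rw [← extend_coe (toLoop p b _), sub_zero, one_mul, zero_mul, add_zero]
    obtain ⟨h0, h1⟩ := t.2
    rcases le_total (t : ℝ) (1 / 2) with h | h
    · rw [toLoop_extend_of_le _ h, max_eq_left (by linarith), act_line_of_le _ (by linarith)]
      ring_nf
      rfl
    rcases le_total (t : ℝ) (3 / 4) with h' | h'
    · rw [toLoop_extend_of_mem _ h h', ofFibreLoop_line,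
        Fibre.line_of_nonpos _ (max_le (by linarith) (by linarith))]
      rfl
    · rw [toLoop_extend_of_ge _ h', max_eq_right (by linarith)]
      rfl
  · rintro ⟨x, γ⟩
    refine Prod.ext rfl (Path.ext (funext fun t => ?_))
    obtain ⟨h0, h1⟩ := t.2
    change line (act p b (x, γ)) ((1 - (1 : ℝ)) * max (1 / 2 - (t : ℝ)) (4 * t - 3)
      + 1 * ((1 + t) / 2)) = γ t
    rw [sub_self, zero_mul, zero_add, one_mul, act_line_of_ge _ (by linarith), ← extend_coe γ]
    congr 1; ring

theorem ofFibreLoop_comp_toFibreLoop :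
    ((ofFibreLoop p b).comp (toFibreLoop p b)).Homotopic (ContinuousMap.id _) := by
  -- At stage `s` the path in `E` is `ε` up to time `s`, and the second point lies over `ε s`. Its
  -- path to `b` runs along `ω⁻¹ · p(ε) · ω'` from parameter `1 / 2 + s / 4`, where the value is `p
  -- (ε s)`. For `s = 0` the parameter `max (1 / 2 - t) (2 * t - 1)` gives `ω` followed by the whole
  -- loop; for `s = 1` only the last quarter `ω'` remains.
  refine homotopic_of (ofLine ⟨fun q => fst _ _ q.2, by fun_prop⟩
    (ofLine ⟨fun q => line q.2 q.1, by fun_prop⟩ (ContinuousMap.const _ ())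
      (fun q t => (toLoop p b q.2).extend
        ((1 - (q.1 : ℝ)) * max (1 / 2 - t) (2 * t - 1) + q.1 * ((3 + t) / 4)))
      (by fun_prop) ?_ ?_) (fun q t => line q.2 (q.1 * t)) (by fun_prop) ?_ ?_) ?_ ?_
  · rintro ⟨s, w⟩
    obtain ⟨h0, h1⟩ := s.2
    have : (1 - (s : ℝ)) * max (1 / 2 - 0) (2 * 0 - 1) + s * ((3 + 0) / 4) = 1 / 2 + s / 4 := by
      norm_num; ring
    simp only [this]
    rw [toLoop_extend_of_mem _ (by linarith) (by linarith)]
    ring_nf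
    rfl
  · rintro ⟨s, w⟩
    have : (1 - (s : ℝ)) * max (1 / 2 - 1) (2 * 1 - 1) + s * ((3 + 1) / 4) = 1 := by
      norm_num
    simp only [this, Path.extend_one]
    rfl
  · rintro ⟨s, w⟩
    simp
  · rintro ⟨s, w⟩
    simp
    rfl
  · intro w
    refine HPullback.ext rfl (HPullback.ext ?_ rfl fun t => ?_) fun t => ?_
    · exact line_zero w
    · change (toLoop p b w).extend ((1 - (0 : ℝ)) * max (1 / 2 - (t : ℝ)) (2 * t - 1)
        + 0 * ((3 + t) / 4)) = HPullback.path (act p b (fst _ _ w, toLoop p b w)) t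
      obtain ⟨h0, h1⟩ := t.2
      rw [← line_coe, sub_zero, one_mul, zero_mul, add_zero]
      rcases le_total (t : ℝ) (1 / 2) with h | h
      · rw [act_line_of_le _ h, max_eq_left (by linarith), toLoop_extend_of_le _ (by linarith)]
        ring_nf
      · rw [act_line_of_ge _ h, max_eq_right (by linarith)]
    · change line w (0 * t) = Fibre.incl p b (fst _ _ w)
      simp
  · intro w
    refine HPullback.ext rfl (HPullback.ext ?_ rfl fun t => ?_) fun t => ?_
    · exact line_one w
    · obtain ⟨h0, h1⟩ := t.2
      change (toLoop p b w).extend ((1 - (1 : ℝ)) * max (1 / 2 - (t : ℝ)) (2 * t - 1)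
        + 1 * ((3 + t) / 4)) = HPullback.path (snd _ _ w) t
      rw [← line_coe, sub_self, zero_mul, zero_add, one_mul, toLoop_extend_of_ge _ (by linarith)]
      ring_nf
    · change line w (1 * t) = HPullback.path w t
      rw [one_mul, line_coe]

theorem isHomotopyEquiv_toFibreLoop : IsHomotopyEquiv (toFibreLoop p b) :=
  isHomotopyEquiv_of _ (ofFibreLoop_comp_toFibreLoop p b) (toFibreLoop_comp_ofFibreLoop p b)

/-- The shear map is by definition `projections` after `ofFibreLoop`, so this is the preceding
homotopy composed with `projections`. -/
theorem shear_comp_toFibreLoop :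
    ((shear p b).comp (toFibreLoop p b)).Homotopic (projections p b) :=
  (ContinuousMap.Homotopic.refl (projections p b)).comp
    (ofFibreLoop_comp_toFibreLoop p b)

end FibreProd

end Fibre

open HPullback

/-! ### Homotopy pullbacks of maps over a space -/

section Over

variable {X Y Z W : Type*}
  [TopologicalSpace X] [TopologicalSpace Y] [TopologicalSpace Z] [TopologicalSpace W]

/-- Homotopy pullback preserves homotopy equivalences that are compatible with the maps to the
base, as are their inverses and the homotopies. -/
theorem isHomotopyEquiv_map_of_over (f : C(W, Z)) {g : C(X, Z)} {h : C(Y, Z)} {φ : C(X, Y)}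
    {ψ : C(Y, X)} (hφ : h.comp φ = (ContinuousMap.id Z).comp g)
    (H : Homotopy (ψ.comp φ) (ContinuousMap.id X)) (hH : ∀ q, g (H q) = g q.2)
    (K : Homotopy (φ.comp ψ) (ContinuousMap.id Y)) (hK : ∀ q, h (K q) = h q.2) :
    IsHomotopyEquiv (HPullback.map (f := f) (f' := f) (ContinuousMap.id W) φ
      (ContinuousMap.id Z) rfl hφ) := by
  -- That `ψ` lies over the base is contained in the condition on `K`, read at time `0`.
  have hψ (y : Y) : g (ψ y) = h y :=
    (DFunLike.congr_fun hφ (ψ y)).symm.trans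
      ((congrArg h (K.map_zero_left y).symm).trans (hK (0, y)))
  refine isHomotopyEquiv_of (HPullback.map (ContinuousMap.id W) ψ (ContinuousMap.id Z) rfl
    (ContinuousMap.ext hψ)) ?_ ?_
  · refine homotopic_of (ofLine ⟨fun q => fst f g q.2, by fun_prop⟩
      ⟨fun q => H (q.1, snd f g q.2), by fun_prop⟩ (fun q t => line q.2 t) (by fun_prop)
      (fun q => line_zero q.2) (fun q => (line_one q.2).trans (hH (q.1, snd f g q.2)).symm)) ?_ ?_
    · exact fun w => HPullback.ext rfl (H.map_zero_left _) fun t => line_coe w t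
    · exact fun w => HPullback.ext rfl (H.map_one_left _) fun t => line_coe w t
  · refine homotopic_of (ofLine ⟨fun q => fst f h q.2, by fun_prop⟩
      ⟨fun q => K (q.1, snd f h q.2), by fun_prop⟩ (fun q t => line q.2 t) (by fun_prop)
      (fun q => line_zero q.2) (fun q => (line_one q.2).trans (hK (q.1, snd f h q.2)).symm)) ?_ ?_
    · exact fun w => HPullback.ext rfl (K.map_zero_left _) fun t => line_coe w t
    · exact fun w => HPullback.ext rfl (K.map_one_left _) fun t => line_coe w t

end Over

/-! ### Spaces of paths between the values of two maps -/

/-- Pairs `(y, π)` with `π` a path from `u y` to `v y`. -/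
def PathsBetween {Y Z : Type*} [TopologicalSpace Y] [TopologicalSpace Z] (u v : C(Y, Z)) :
    Type _ :=
  {t : Y × C(I, Z) // t.2 0 = u t.1 ∧ t.2 1 = v t.1}

instance {Y Z : Type*} [TopologicalSpace Y] [TopologicalSpace Z] (u v : C(Y, Z)) :
    TopologicalSpace (PathsBetween u v) :=
  inferInstanceAs (TopologicalSpace {t : Y × C(I, Z) // t.2 0 = u t.1 ∧ t.2 1 = v t.1})

/-- The concatenation of two families of functions on the line. -/
def concat {P Z : Type*} (G₁ G₂ : P → ℝ → Z) (q : P) (r : ℝ) : Z :=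
  if r ≤ 1 / 2 then G₁ q (2 * r) else G₂ q (2 * r - 1)

section Concat

variable {P Z : Type*} {G₁ G₂ : P → ℝ → Z}

theorem concat_of_le (q : P) {r : ℝ} (hr : r ≤ 1 / 2) : concat G₁ G₂ q r = G₁ q (2 * r) :=
  if_pos hr

theorem concat_of_ge (h : ∀ q, G₁ q 1 = G₂ q 0) (q : P) {r : ℝ} (hr : 1 / 2 ≤ r) :
    concat G₁ G₂ q r = G₂ q (2 * r - 1) := by
  rcases hr.eq_or_lt with rfl | hr
  · rw [concat_of_le q le_rfl]
    norm_num [h]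
  · exact if_neg (not_le.2 hr)

theorem continuous_concat [TopologicalSpace P] [TopologicalSpace Z]
    (h₁ : Continuous fun q : P × ℝ => G₁ q.1 q.2) (h₂ : Continuous fun q : P × ℝ => G₂ q.1 q.2)
    (h : ∀ q, G₁ q 1 = G₂ q 0) : Continuous fun q : P × ℝ => concat G₁ G₂ q.1 q.2 := by
  refine Continuous.if_le
    (h₁.comp (by fun_prop : Continuous fun q : P × ℝ => (q.1, 2 * q.2)))
    (h₂.comp (by fun_prop : Continuous fun q : P × ℝ => (q.1, 2 * q.2 - 1)))
    continuous_snd continuous_const fun q hq => ?_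
  norm_num [hq, h]

end Concat

namespace PathsBetween

section Basic

variable {P Y Z : Type*} [TopologicalSpace P] [TopologicalSpace Y] [TopologicalSpace Z]

/-- The projection `(y, π) ↦ y`. -/
def pt (u v : C(Y, Z)) : C(PathsBetween u v, Y) :=
  ⟨fun t => t.1.1, continuous_fst.comp continuous_subtype_val⟩

variable {u v : C(Y, Z)}

/-- The path `π` of a pair `(y, π)`. -/
def path (t : PathsBetween u v) : Path (u (pt u v t)) (v (pt u v t)) where
  toContinuousMap := t.1.2
  source' := t.2.1
  target' := t.2.2

theorem continuous_path : Continuous fun q : PathsBetween u v × I => path q.1 q.2 :=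
  continuous_eval.comp
    (((continuous_snd.comp continuous_subtype_val).comp continuous_fst).prodMk continuous_snd)

/-- The path `π` of a pair `(y, π)`, extended to the line. -/
def line (t : PathsBetween u v) (r : ℝ) : Z := (path t).extend r

@[fun_prop]
theorem continuous_line {a : P → PathsBetween u v} {r : P → ℝ} (ha : Continuous a)
    (hr : Continuous r) : Continuous fun q => line (a q) (r q) :=
  Continuous.IccExtend (f := fun q t => path (a q) t)
    (continuous_path.comp ((ha.comp continuous_fst).prodMk continuous_snd)) hr

theorem line_of_nonpos (t : PathsBetween u v) {r : ℝ} (hr : r ≤ 0) : line t r = u (pt u v t) :=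
  Path.extend_of_le_zero _ hr

theorem line_of_one_le (t : PathsBetween u v) {r : ℝ} (hr : 1 ≤ r) : line t r = v (pt u v t) :=
  Path.extend_of_one_le _ hr

theorem line_coe (t : PathsBetween u v) (r : I) : line t r = path t r := extend_coe _ _

theorem ext {t t' : PathsBetween u v} (h₁ : pt u v t = pt u v t')
    (h : ∀ r : I, path t r = path t' r) : t = t' :=
  Subtype.ext (Prod.ext h₁ (ContinuousMap.ext h))

/-- A map to the space of pairs `(y, π)` given by a continuous family of functions on the line. -/
def ofLine (a : C(P, Y)) (G : P → ℝ → Z) (hG : Continuous fun q : P × ℝ => G q.1 q.2)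
    (h₀ : ∀ q, G q 0 = u (a q)) (h₁ : ∀ q, G q 1 = v (a q)) : C(P, PathsBetween u v) where
  toFun q := ⟨(a q, ⟨fun t => G q t,
    hG.comp (by fun_prop : Continuous fun t : I => (q, (t : ℝ)))⟩),
    by simpa using h₀ q, by simpa using h₁ q⟩
  continuous_toFun := by
    refine Continuous.subtype_mk (a.continuous.prodMk ?_) _
    exact ContinuousMap.continuous_of_continuous_uncurry _
      (hG.comp (by fun_prop : Continuous fun q : P × I => (q.1, (q.2 : ℝ))))

theorem line_ofLine (a : C(P, Y)) (G : P → ℝ → Z) (hG : Continuous fun q : P × ℝ => G q.1 q.2)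
    (h₀ : ∀ q, G q 0 = u (a q)) (h₁ : ∀ q, G q 1 = v (a q)) (q : P) {r : ℝ} (hr : r ∈ I) :
    line (ofLine a G hG h₀ h₁ q) r = G q r :=
  line_coe _ ⟨r, hr⟩

end Basic

/-! ### The space of paths as a homotopy pullback along the diagonal -/

section Diag

variable {Y Z : Type*} [TopologicalSpace Y] [TopologicalSpace Z] (u v : C(Y, Z))

/-- The map `(y, π) ↦ (v y, (const, π⁻¹), y)`. -/
def toHPullback : C(PathsBetween u v, HPullback (diag Z) (v.prodMk u)) :=
  HPullback.ofLine (v.comp (pt u v)) (pt u v) (fun t r => (v (pt u v t), line t (1 - r)))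
    (by fun_prop) (fun t => Prod.ext rfl (line_of_one_le t (by norm_num)))
    (fun t => Prod.ext rfl (line_of_nonpos t (by norm_num)))

theorem ofHPullback_aux (w : HPullback (diag Z) (v.prodMk u)) :
    (HPullback.line w (1 - 1)).2 = (HPullback.line w 0).1 := by
  rw [sub_self, HPullback.line_zero]
  rfl

/-- The map `(z, (π₁, π₂), y) ↦ (y, π₂⁻¹ · π₁)`. -/
def ofHPullback : C(HPullback (diag Z) (v.prodMk u), PathsBetween u v) :=
  ofLine (snd _ _)
    (concat (fun w r => (HPullback.line w (1 - r)).2) (fun w r => (HPullback.line w r).1))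
    (continuous_concat (by fun_prop) (by fun_prop) (ofHPullback_aux u v))
    (fun w => by
      rw [concat_of_le w (by norm_num), mul_zero, sub_zero, HPullback.line_one]
      rfl)
    (fun w => by
      rw [concat_of_ge (ofHPullback_aux u v) w (by norm_num), HPullback.line_of_one_le w (by norm_num)]
      rfl)

variable {u v}

theorem line_ofHPullback_of_le (w : HPullback (diag Z) (v.prodMk u)) {r : ℝ} (h₀ : 0 ≤ r)
    (hr : r ≤ 1 / 2) : line (ofHPullback u v w) r = (HPullback.line w (1 - 2 * r)).2 := by
  unfold ofHPullback
  rw [line_ofLine _ _ _ _ _ w ⟨h₀, by linarith⟩, concat_of_le w hr]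

theorem line_ofHPullback_of_ge (w : HPullback (diag Z) (v.prodMk u)) {r : ℝ} (hr : 1 / 2 ≤ r)
    (h₁ : r ≤ 1) : line (ofHPullback u v w) r = (HPullback.line w (2 * r - 1)).1 := by
  unfold ofHPullback
  rw [line_ofLine _ _ _ _ _ w ⟨by linarith, h₁⟩, concat_of_ge (ofHPullback_aux u v) w hr]

variable (u v)

/-- In a point `(z, (π₁, π₂), y)` the point `z` can be slid along `π₁` to `v y`; then `π₁` becomes
constant and all information is in the path from `u y` to `v y`. -/
theorem isHomotopyEquiv_toHPullback : IsHomotopyEquiv (toHPullback u v) := by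
  refine isHomotopyEquiv_of (ofHPullback u v) ?_ ?_
  -- This round trip turns `π` into `π · const`, that is, `π` at the parameter `2 * r`.
  · refine homotopic_of (ofLine ⟨fun q => pt u v q.2, by fun_prop⟩
      (fun q r => line q.2 ((1 - (q.1 : ℝ)) * (2 * r) + q.1 * r)) (by fun_prop)
      (fun q => line_of_nonpos _ (by simp)) (fun q => line_of_one_le _ ?_)) ?_ ?_
    · linarith [q.1.2.2]
    · refine fun t => PathsBetween.ext rfl fun r => ?_
      obtain ⟨h0, h1⟩ := r.2
      change line t ((1 - (0 : ℝ)) * (2 * r) + 0 * r) = path (ofHPullback u v (toHPullback u v t)) r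
      rw [← line_coe, sub_zero, one_mul, zero_mul, add_zero]
      rcases le_total (r : ℝ) (1 / 2) with h | h
      · rw [line_ofHPullback_of_le _ h0 h]
        unfold toHPullback
        rw [HPullback.line_ofLine _ _ _ _ _ _ t ⟨by linarith, by linarith⟩, sub_sub_cancel]
      · rw [line_ofHPullback_of_ge _ h h1, line_of_one_le _ (by linarith)]
        rfl
    · refine fun t => PathsBetween.ext rfl fun r => ?_
      change line t ((1 - (1 : ℝ)) * (2 * r) + 1 * r) = path t r
      rw [← line_coe, sub_self, zero_mul, zero_add, one_mul]
  -- At stage `s` the first point is `π₁ (1 - s)`. On `π₂⁻¹ · π₁` this is the parameter `(2 - s) /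
  -- 2`, from which the second path runs back to `u y`; for `s = 1` it starts at `1 / 2` and is
  -- `π₂`.
  · refine homotopic_of (HPullback.ofLine ⟨fun q => (HPullback.line q.2 (1 - q.1)).1, by fun_prop⟩
      ⟨fun q => snd _ _ q.2, by fun_prop⟩
      (fun q r => ((HPullback.line q.2 (1 - q.1 + q.1 * r)).1,
        line (ofHPullback u v q.2) ((2 - q.1) / 2 * (1 - r)))) (by fun_prop) ?_ ?_) ?_ ?_
    · rintro ⟨s, w⟩
      refine Prod.ext (by simp [diag]; rfl) ?_
      have := s.2.2
      change line (ofHPullback u v w) ((2 - s) / 2 * (1 - 0)) = (HPullback.line w (1 - s)).1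
      rw [line_ofHPullback_of_ge _ (by linarith) (by linarith [s.2.1])]
      congr 2; ring
    · rintro ⟨s, w⟩
      refine Prod.ext ?_ ?_
      · change (HPullback.line w (1 - s + s * 1)).1 = _
        rw [mul_one, sub_add_cancel, HPullback.line_one]
        rfl
      · exact line_of_nonpos _ (by simp)
    · intro w
      refine HPullback.ext ?_ rfl fun r => Prod.ext ?_ ?_
      · change (HPullback.line w (1 - 0)).1 = _
        rw [sub_zero, HPullback.line_one]
        rfl
      · change (HPullback.line w (1 - 0 + 0 * r)).1 = _
        rw [sub_zero, zero_mul, add_zero, HPullback.line_one]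
        rfl
      · change line (ofHPullback u v w) ((2 - 0) / 2 * (1 - r)) = line (ofHPullback u v w) (1 - r)
        congr 1; ring
    · intro w
      refine HPullback.ext ?_ rfl fun r => Prod.ext ?_ ?_
      · change (HPullback.line w (1 - 1)).1 = _
        rw [sub_self, HPullback.line_zero]
        rfl
      · change (HPullback.line w (1 - 1 + 1 * r)).1 = (HPullback.path w r).1
        rw [sub_self, zero_add, one_mul, HPullback.line_coe]
      · change line (ofHPullback u v w) ((2 - 1) / 2 * (1 - r)) = (HPullback.path w r).2
        obtain ⟨h0, h1⟩ := r.2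
        rw [line_ofHPullback_of_le _ (by linarith) (by linarith), ← HPullback.line_coe]
        congr 2; ring

end Diag

/-! ### Fibres of spaces of paths over a factor -/

section Slice

variable {X L Z : Type*} [TopologicalSpace X] [TopologicalSpace L] [TopologicalSpace Z]
  (u : C(X × L, Z)) (v : C(X, Z)) (l : L)

/-- The restriction of a map on `X × L` to `X × {l}`. -/
def slice : C(X, Z) := u.comp ((ContinuousMap.id X).prodMk (ContinuousMap.const X l))

/-- The projection `((x, l), π) ↦ l`. -/
def param : C(PathsBetween u (v.comp ContinuousMap.fst), L) :=
  ContinuousMap.snd.comp (pt _ _)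

/-- The inclusion `(x, π) ↦ ((x, l), π)`. -/
def ofSlice : C(PathsBetween (slice u l) v, PathsBetween u (v.comp ContinuousMap.fst)) :=
  ofLine ((pt _ _).prodMk (ContinuousMap.const _ l)) line (by fun_prop)
    (fun t => line_of_nonpos t le_rfl) (fun t => line_of_one_le t le_rfl)

/-- The homotopy fibre of `param` over `l`. -/
abbrev ParamFibre : Type _ := HPullback (ContinuousMap.const Unit l) (param u v)

variable {u v l} in
theorem toSlice_aux (w : ParamFibre u v l) :
    u ((pt _ _ (snd _ _ w)).1, HPullback.line w 1) = line (snd _ _ w) 0 := by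
  rw [HPullback.line_one, line_of_nonpos _ le_rfl]
  rfl

/-- The map `(σ, ((x, l'), π)) ↦ (x, u(x, σ) · π)`. -/
def toSlice : C(ParamFibre u v l, PathsBetween (slice u l) v) :=
  ofLine (ContinuousMap.fst.comp ((pt _ _).comp (snd _ _)))
    (concat (fun w r => u ((pt _ _ (snd _ _ w)).1, HPullback.line w r))
      (fun w r => line (snd _ _ w) r))
    (continuous_concat (by fun_prop) (by fun_prop) toSlice_aux)
    (fun w => by
      rw [concat_of_le w (by norm_num), mul_zero, HPullback.line_zero]
      rfl)
    (fun w => by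
      rw [concat_of_ge toSlice_aux w (by norm_num), line_of_one_le _ (by norm_num)]
      rfl)

/-- The map `(x, π) ↦ (const, ((x, l), π))`. -/
def sliceToFibre : C(PathsBetween (slice u l) v, ParamFibre u v l) :=
  HPullback.ofLine (ContinuousMap.const _ ()) (ofSlice u v l) (fun _ _ => l) (by fun_prop)
    (fun _ => rfl) (fun _ => rfl)

variable {u v l}

theorem line_ofSlice (t : PathsBetween (slice u l) v) {r : ℝ} (hr : r ∈ I) :
    line (ofSlice u v l t) r = line t r :=
  line_coe (ofSlice u v l t) ⟨r, hr⟩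

theorem line_toSlice_of_le (w : ParamFibre u v l) {r : ℝ} (h₀ : 0 ≤ r) (hr : r ≤ 1 / 2) :
    line (toSlice u v l w) r = u ((pt _ _ (snd _ _ w)).1, HPullback.line w (2 * r)) := by
  unfold toSlice
  rw [line_ofLine _ _ _ _ _ w ⟨h₀, by linarith⟩, concat_of_le w hr]

theorem line_toSlice_of_ge (w : ParamFibre u v l) {r : ℝ} (hr : 1 / 2 ≤ r) (h₁ : r ≤ 1) :
    line (toSlice u v l w) r = line (snd _ _ w) (2 * r - 1) := by
  unfold toSlice
  rw [line_ofLine _ _ _ _ _ w ⟨by linarith, h₁⟩, concat_of_ge toSlice_aux w hr]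

variable (u v l)

theorem toSlice_comp_sliceToFibre :
    ((toSlice u v l).comp (sliceToFibre u v l)).Homotopic (ContinuousMap.id _) := by
  -- Here `π` becomes `const · π`, that is, `π` at the parameter `2 * r - 1`.
  refine homotopic_of (ofLine ⟨fun q => pt _ _ q.2, by fun_prop⟩
    (fun q r => line q.2 ((1 - (q.1 : ℝ)) * (2 * r - 1) + q.1 * r)) (by fun_prop)
    (fun q => line_of_nonpos _ ?_) (fun q => line_of_one_le _ ?_)) ?_ ?_
  · linarith [q.1.2.2]
  · linarith
  · refine fun t => PathsBetween.ext rfl fun r => ?_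
    change line t ((1 - (0 : ℝ)) * (2 * r - 1) + 0 * r) = path (toSlice u v l (sliceToFibre u v l t)) r
    rw [← line_coe, sub_zero, one_mul, zero_mul, add_zero]
    obtain ⟨h0, h1⟩ := r.2
    rcases le_total (r : ℝ) (1 / 2) with h | h
    · rw [line_toSlice_of_le _ h0 h, line_of_nonpos _ (by linarith)]
      rfl
    · rw [line_toSlice_of_ge _ h h1]
      exact (line_ofSlice t ⟨by linarith, by linarith⟩).symm
  · refine fun t => PathsBetween.ext rfl fun r => ?_
    change line t ((1 - (1 : ℝ)) * (2 * r - 1) + 1 * r) = path t r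
    rw [← line_coe, sub_self, zero_mul, zero_add, one_mul]

theorem sliceToFibre_comp_toSlice :
    ((sliceToFibre u v l).comp (toSlice u v l)).Homotopic (ContinuousMap.id _) := by
  -- At stage `s` the path `σ` is cut off at time `s`, and the part of `u(x, σ)` not yet used stays
  -- in front of `π`: it begins at parameter `s / 2` of `u(x, σ) · π`.
  refine homotopic_of (HPullback.ofLine (ContinuousMap.const _ ())
    (ofLine ⟨fun q => ((pt _ _ (snd _ _ q.2)).1, HPullback.line q.2 q.1), by fun_prop⟩
      (fun q r => line (toSlice u v l q.2) ((1 - r) * (q.1 / 2) + r)) (by fun_prop) ?_ ?_)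
    (fun q r => HPullback.line q.2 (q.1 * r)) (by fun_prop) ?_ ?_) ?_ ?_
  · rintro ⟨s, w⟩
    have := s.2.2
    change line (toSlice u v l w) ((1 - 0) * (s / 2) + 0) = u ((pt _ _ (snd _ _ w)).1, HPullback.line w s)
    rw [line_toSlice_of_le _ (by linarith [s.2.1]) (by linarith)]
    congr 3; ring
  · rintro ⟨s, w⟩
    exact line_of_one_le _ (by simp)
  · rintro ⟨s, w⟩
    exact HPullback.line_of_nonpos _ (by simp)
  · rintro ⟨s, w⟩
    change HPullback.line w (s * 1) = HPullback.line w s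
    rw [mul_one]
  · intro w
    refine HPullback.ext rfl (PathsBetween.ext (Prod.ext rfl ?_) fun r => ?_) fun r => ?_
    · exact HPullback.line_zero w
    · change line (toSlice u v l w) ((1 - r) * (0 / 2) + r) = line (toSlice u v l w) r
      rw [zero_div, mul_zero, zero_add]
    · exact HPullback.line_of_nonpos w (by simp)
  · intro w
    refine HPullback.ext rfl (PathsBetween.ext (Prod.ext rfl ?_) fun r => ?_) fun r => ?_
    · exact HPullback.line_one w
    · obtain ⟨h0, h1⟩ := r.2
      change line (toSlice u v l w) ((1 - r) * (1 / 2) + r) = path (snd _ _ w) r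
      rw [line_toSlice_of_ge _ (by linarith) (by linarith), ← line_coe]
      congr 1; ring
    · change HPullback.line w (1 * r) = HPullback.path w r
      rw [one_mul, HPullback.line_coe]

theorem isHomotopyEquiv_toSlice : IsHomotopyEquiv (toSlice u v l) :=
  isHomotopyEquiv_of _ (sliceToFibre_comp_toSlice u v l) (toSlice_comp_sliceToFibre u v l)

theorem ofSlice_comp_toSlice :
    ((ofSlice u v l).comp (toSlice u v l)).Homotopic (snd _ _) :=
  (ContinuousMap.Homotopic.refl (snd (ContinuousMap.const Unit l) (param u v))).comp
    (sliceToFibre_comp_toSlice u v l)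

end Slice

end PathsBetween

/-! ### Free loops as closed paths -/

namespace FreeLoop

variable {X Y P : Type*} [TopologicalSpace X] [TopologicalSpace Y] [TopologicalSpace P]

/-- A free loop, given by paths `α`, `β` from `x` to `y`, as the closed path `α · β⁻¹`. -/
def circ : FreeLoop X → ℝ → X :=
  concat (fun ℓ r => (line ℓ r).1) (fun ℓ r => (line ℓ (1 - r)).2)

theorem circ_aux (ℓ : FreeLoop X) : (line ℓ 1).1 = (line ℓ (1 - 0)).2 := by
  rw [sub_zero, line_one]
  rfl

theorem circ_of_le (ℓ : FreeLoop X) {r : ℝ} (hr : r ≤ 1 / 2) : circ ℓ r = (line ℓ (2 * r)).1 :=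
  concat_of_le ℓ hr

theorem circ_of_ge (ℓ : FreeLoop X) {r : ℝ} (hr : 1 / 2 ≤ r) :
    circ ℓ r = (line ℓ (2 - 2 * r)).2 := by
  refine (concat_of_ge circ_aux ℓ hr).trans ?_
  rw [show 1 - (2 * r - 1) = 2 - 2 * r by ring]

@[fun_prop]
theorem continuous_circ {u : P → FreeLoop X} {r : P → ℝ} (hu : Continuous u)
    (hr : Continuous r) : Continuous fun q => circ (u q) (r q) :=
  (continuous_concat (by fun_prop) (by fun_prop) circ_aux).comp (hu.prodMk hr)

theorem circ_of_nonpos (ℓ : FreeLoop X) {r : ℝ} (hr : r ≤ 0) : circ ℓ r = ev X ℓ := by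
  rw [circ_of_le ℓ (by linarith), line_of_nonpos ℓ (by linarith)]
  rfl

theorem circ_of_one_le (ℓ : FreeLoop X) {r : ℝ} (hr : 1 ≤ r) : circ ℓ r = ev X ℓ := by
  rw [circ_of_ge ℓ (by linarith), line_of_nonpos ℓ (by linarith)]
  rfl

theorem circ_map (f : C(X, Y)) (ℓ : FreeLoop X) (r : ℝ) :
    circ (FreeLoop.map f ℓ) r = f (circ ℓ r) := by
  rcases le_total r (1 / 2) with h | h
  · rw [circ_of_le _ h, circ_of_le _ h]
    rfl
  · rw [circ_of_ge _ h, circ_of_ge _ h]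
    rfl

theorem circ_loopIncl {b : X} (γ : LoopSpace X b) (r : ℝ) :
    circ (loopIncl b γ) r = γ.extend (2 * r) := by
  rcases le_total r (1 / 2) with h | h
  · rw [circ_of_le _ h]
    rfl
  · rw [circ_of_ge _ h, Path.extend_of_one_le _ (by linarith)]
    rfl

/-- The closed path loses nothing: the first path is read off at `r / 2` and the second at `1 - r /
2`. -/
theorem ext_circ {ℓ ℓ' : FreeLoop X} (h : ∀ r : I, circ ℓ r = circ ℓ' r) : ℓ = ℓ' := by
  have hl (r : I) : (HPullback.path ℓ r).1 = (HPullback.path ℓ' r).1 := by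
    obtain ⟨h0, h1⟩ := r.2
    have := h ⟨(r : ℝ) / 2, by linarith, by linarith⟩
    rw [circ_of_le _ (by change (r : ℝ) / 2 ≤ _; linarith),
      circ_of_le _ (by change (r : ℝ) / 2 ≤ _; linarith)] at this
    change (line ℓ (2 * ((r : ℝ) / 2))).1 = (line ℓ' (2 * ((r : ℝ) / 2))).1 at this
    rwa [mul_div_cancel₀ _ two_ne_zero, line_coe, line_coe] at this
  have hr (r : I) : (HPullback.path ℓ r).2 = (HPullback.path ℓ' r).2 := by
    obtain ⟨h0, h1⟩ := r.2
    have := h ⟨1 - (r : ℝ) / 2, by linarith, by linarith⟩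
    rw [circ_of_ge _ (by change _ ≤ 1 - (r : ℝ) / 2; linarith),
      circ_of_ge _ (by change _ ≤ 1 - (r : ℝ) / 2; linarith)] at this
    change (line ℓ (2 - 2 * (1 - (r : ℝ) / 2))).2 = (line ℓ' (2 - 2 * (1 - (r : ℝ) / 2))).2 at this
    rwa [show 2 - 2 * (1 - (r : ℝ) / 2) = r by ring, line_coe, line_coe] at this
  refine HPullback.ext ?_ ?_ fun r => Prod.ext (hl r) (hr r)
  · have := hl 0
    rwa [(HPullback.path ℓ).source, (HPullback.path ℓ').source] at this
  · have := hl 1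
    rwa [(HPullback.path ℓ).target, (HPullback.path ℓ').target] at this

/-- The family of free loops given by a continuous family of closed paths. -/
def ofCirc (G : P → ℝ → X) (hG : Continuous fun q : P × ℝ => G q.1 q.2)
    (h : ∀ q, G q 0 = G q 1) : C(P, FreeLoop X) :=
  HPullback.ofLine ⟨fun q => G q 0, hG.comp (by fun_prop : Continuous fun q : P => (q, (0 : ℝ)))⟩
    ⟨fun q => G q (1 / 2), hG.comp (by fun_prop : Continuous fun q : P => (q, (1 / 2 : ℝ)))⟩
    (fun q r => (G q (r / 2), G q (1 - r / 2)))
    ((hG.comp (by fun_prop : Continuous fun q : P × ℝ => (q.1, q.2 / 2))).prodMk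
      (hG.comp (by fun_prop : Continuous fun q : P × ℝ => (q.1, 1 - q.2 / 2))))
    (fun q => Prod.ext (by simp [diag]) (by simp [diag, h]))
    (fun q => Prod.ext rfl (by norm_num [diag]))

theorem circ_ofCirc (G : P → ℝ → X) (hG : Continuous fun q : P × ℝ => G q.1 q.2)
    (h : ∀ q, G q 0 = G q 1) (q : P) {r : ℝ} (hr : r ∈ I) : circ (ofCirc G hG h q) r = G q r := by
  obtain ⟨h0, h1⟩ := hr
  unfold ofCirc
  rcases le_total r (1 / 2) with h | h
  · rw [circ_of_le _ h, line_ofLine _ _ _ _ _ _ q ⟨by linarith, by linarith⟩]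
    ring_nf
  · rw [circ_of_ge _ h, line_ofLine _ _ _ _ _ _ q ⟨by linarith, by linarith⟩]
    ring_nf

end FreeLoop

/-! ### The fibre of the free loop space -/

section Based

variable {B : Type*} [TopologicalSpace B] (b : B)

/-- The homotopy fibre of the evaluation of free loops over `b`. -/
abbrev EvFibre : Type _ := HPullback (FreeLoop.ev B) (ContinuousMap.const Unit b)

variable {b}

theorem EvFibre.aux₁ (w : EvFibre b) :
    FreeLoop.circ (fst _ _ w) 1 = line w 0 := by
  rw [FreeLoop.circ_of_one_le _ le_rfl, line_zero]

/-- For a point `(ℓ, τ)` of the fibre the concatenation `ℓ · τ`. -/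
def EvFibre.tail : EvFibre b → ℝ → B := concat (fun w => FreeLoop.circ (fst _ _ w)) line

theorem EvFibre.aux₂ (w : EvFibre b) : line w (1 - 1) = EvFibre.tail w 0 := by
  unfold EvFibre.tail
  rw [concat_of_le w (by norm_num), sub_self, mul_zero, FreeLoop.circ_of_nonpos _ le_rfl,
    line_zero]

/-- For a point `(ℓ, τ)` of the fibre the concatenation `τ⁻¹ · (ℓ · τ)`. -/
def EvFibre.full : EvFibre b → ℝ → B := concat (fun w r => line w (1 - r)) EvFibre.tail

@[fun_prop]
theorem EvFibre.continuous_full {P : Type*} [TopologicalSpace P] {u : P → EvFibre b} {r : P → ℝ}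
    (hu : Continuous u) (hr : Continuous r) : Continuous fun q => EvFibre.full (u q) (r q) :=
  (continuous_concat (by fun_prop) (continuous_concat (by fun_prop) (by fun_prop) EvFibre.aux₁)
    EvFibre.aux₂).comp (hu.prodMk hr)

theorem EvFibre.full_of_le (w : EvFibre b) {r : ℝ} (hr : r ≤ 1 / 2) :
    EvFibre.full w r = line w (1 - 2 * r) :=
  concat_of_le w hr

theorem EvFibre.full_of_mem (w : EvFibre b) {r : ℝ} (hr : 1 / 2 ≤ r) (hr' : r ≤ 3 / 4) :
    EvFibre.full w r = FreeLoop.circ (fst _ _ w) (4 * r - 2) := by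
  refine (concat_of_ge EvFibre.aux₂ w hr).trans ((concat_of_le w (by linarith)).trans ?_)
  rw [show 2 * (2 * r - 1) = 4 * r - 2 by ring]

theorem EvFibre.full_of_ge (w : EvFibre b) {r : ℝ} (hr : 3 / 4 ≤ r) :
    EvFibre.full w r = line w (4 * r - 3) := by
  refine (concat_of_ge EvFibre.aux₂ w (by linarith)).trans
    ((concat_of_ge EvFibre.aux₁ w (by linarith)).trans ?_)
  rw [show 2 * (2 * r - 1) - 1 = 4 * r - 3 by ring]

variable (b)

/-- The map sending a point `(ℓ, τ)` of the fibre to the loop `τ⁻¹ · (ℓ · τ)`. -/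
def EvFibre.toLoop : C(EvFibre b, LoopSpace B b) :=
  mkLoop EvFibre.full (by fun_prop)
    (fun w => by rw [EvFibre.full_of_le w (by norm_num), line_of_one_le w (by norm_num)]; rfl)
    (fun w => by rw [EvFibre.full_of_ge w (by norm_num), line_of_one_le w (by norm_num)]; rfl)

/-- The map `γ ↦ ((γ, const), const)`. -/
def EvFibre.ofLoop : C(LoopSpace B b, EvFibre b) :=
  HPullback.lift (loopIncl b) (ContinuousMap.const (LoopSpace B b) ())
    (ContinuousMap.Homotopy.refl (ContinuousMap.const _ b))

/-- The loop `γ` is the first half of its closed path, which in turn occupies `[1 / 2, 3 / 4]`; so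
`γ` is run on `[1 / 2, 5 / 8]`. -/
theorem EvFibre.full_ofLoop (γ : LoopSpace B b) (r : ℝ) :
    EvFibre.full (EvFibre.ofLoop b γ) r = γ.extend (8 * r - 4) := by
  rcases le_total r (1 / 2) with h | h
  · rw [full_of_le _ h, Path.extend_of_le_zero _ (by linarith)]
    rfl
  rcases le_total r (3 / 4) with h' | h'
  · rw [full_of_mem _ h h', show 8 * r - 4 = 2 * (4 * r - 2) by ring]
    exact FreeLoop.circ_loopIncl γ _
  · rw [full_of_ge _ h', Path.extend_of_one_le _ (by linarith)]
    rfl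

theorem EvFibre.toLoop_comp_ofLoop :
    ((toLoop b).comp (ofLoop b)).Homotopic (ContinuousMap.id _) := by
  refine homotopic_of (mkLoop
    (fun q t => q.2.extend ((1 - (q.1 : ℝ)) * (8 * t - 4) + q.1 * t)) (by fun_prop) ?_ ?_) ?_ ?_
  · exact fun q => Path.extend_of_le_zero _ (by linarith [q.1.2.2])
  · exact fun q => Path.extend_of_one_le _ (by linarith [q.1.2.2])
  · refine fun γ => Path.ext (funext fun t => ?_)
    change γ.extend ((1 - (0 : ℝ)) * (8 * t - 4) + 0 * t) = full (ofLoop b γ) t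
    rw [full_ofLoop, sub_zero, one_mul, zero_mul, add_zero]
  · refine fun γ => Path.ext (funext fun t => ?_)
    change γ.extend ((1 - (1 : ℝ)) * (8 * t - 4) + 1 * t) = γ t
    rw [sub_self, zero_mul, zero_add, one_mul, extend_coe]

variable {b}

theorem EvFibre.full_of_nonpos (w : EvFibre b) {r : ℝ} (hr : r ≤ 0) : full w r = b := by
  rw [full_of_le w (by linarith), line_of_one_le w (by linarith)]
  rfl

theorem EvFibre.full_of_one_le (w : EvFibre b) {r : ℝ} (hr : 1 ≤ r) : full w r = b := by
  rw [full_of_ge w (by linarith), line_of_one_le w (by linarith)]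
  rfl

theorem EvFibre.toLoop_extend (w : EvFibre b) (r : ℝ) :
    (toLoop b w).extend r = full w (min r 1) := by
  rcases le_total r 1 with h | h
  · rw [min_eq_left h]
    rcases le_total 0 r with h' | h'
    · exact Path.extend_apply _ ⟨h', h⟩
    · rw [Path.extend_of_le_zero _ h', full_of_nonpos _ h']
  · rw [Path.extend_of_one_le _ h, min_eq_right h, full_of_one_le _ le_rfl]

variable (b)

/-- The free loops in the homotopy from `((τ⁻¹ · (ℓ · τ), const), const)` to `(ℓ, τ)`. -/
def EvFibre.circHomotopy : C(I × EvFibre b, FreeLoop B) :=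
  FreeLoop.ofCirc
    -- The ends of the parameter are `s / 2` and `1 - s / 4`, and at both `τ⁻¹ · (ℓ · τ)` has the
    -- value `τ (1 - s)`, so the path is closed. The truncation of `2 * c` at `1` is needed for
    -- this. At `s = 1` the parameter covers exactly the quarter occupied by `ℓ`.
    (fun q c => full q.2 ((1 - (q.1 : ℝ)) * min (2 * c) 1 + q.1 * (1 / 2 + c / 4)))
    (by fun_prop) (by
      rintro ⟨s, w⟩
      obtain ⟨h0, h1⟩ := s.2
      have e₀ : (1 - (s : ℝ)) * min (2 * 0) 1 + s * (1 / 2 + 0 / 4) = s / 2 := by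
        norm_num; ring
      have e₁ : (1 - (s : ℝ)) * min (2 * 1) 1 + s * (1 / 2 + 1 / 4) = 1 - s / 4 := by
        norm_num; ring
      simp only [e₀, e₁]
      rw [full_of_le _ (by linarith), full_of_ge _ (by linarith)]
      ring_nf)

theorem EvFibre.circ_circHomotopy (s : I) (w : EvFibre b) (c : I) :
    FreeLoop.circ (circHomotopy b (s, w)) c =
      full w ((1 - (s : ℝ)) * min (2 * (c : ℝ)) 1 + s * (1 / 2 + (c : ℝ) / 4)) := by
  unfold circHomotopy
  rw [FreeLoop.circ_ofCirc _ _ _ _ c.2]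

theorem EvFibre.ofLoop_comp_toLoop :
    ((ofLoop b).comp (toLoop b)).Homotopic (ContinuousMap.id _) := by
  -- The path to `b` at stage `s` is the end piece of `τ` from time `1 - s`, found by running `τ⁻¹`
  -- back from parameter `s / 2`.
  refine homotopic_of (HPullback.ofLine (circHomotopy b) (ContinuousMap.const _ ())
    (fun q r => full q.2 (q.1 / 2 * (1 - r))) (by fun_prop) ?_ ?_) ?_ ?_
  · rintro ⟨s, w⟩
    change full w (s / 2 * (1 - 0)) =
      full w ((1 - (s : ℝ)) * min (2 * 0) 1 + s * (1 / 2 + 0 / 4))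
    norm_num
    ring_nf
  · rintro ⟨s, w⟩
    exact full_of_nonpos w (by simp)
  · intro w
    refine HPullback.ext (FreeLoop.ext_circ fun c => ?_) rfl fun r => ?_
    · change FreeLoop.circ (circHomotopy b (0, w)) c = FreeLoop.circ (loopIncl b (toLoop b w)) c
      rw [circ_circHomotopy, FreeLoop.circ_loopIncl, toLoop_extend]
      simp
    · exact full_of_nonpos w (by simp)
  · intro w
    refine HPullback.ext (FreeLoop.ext_circ fun c => ?_) rfl fun r => ?_
    · obtain ⟨h0, h1⟩ := c.2
      change FreeLoop.circ (circHomotopy b (1, w)) c = FreeLoop.circ (fst _ _ w) c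
      rw [circ_circHomotopy, Set.Icc.coe_one, sub_self, zero_mul, zero_add, one_mul,
        full_of_mem _ (by linarith) (by linarith)]
      ring_nf
    · obtain ⟨h0, h1⟩ := r.2
      change full w (1 / 2 * (1 - r)) = HPullback.path w r
      rw [full_of_le _ (by linarith), ← line_coe]
      ring_nf

theorem isHomotopyPullback_loopIncl :
    IsHomotopyPullback (loopIncl b) (ContinuousMap.const (LoopSpace B b) ())
      (FreeLoop.ev B) (ContinuousMap.const Unit b) :=
  ⟨ContinuousMap.Homotopy.refl (ContinuousMap.const _ b), isHomotopyEquiv_of (EvFibre.toLoop b)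
    (EvFibre.toLoop_comp_ofLoop b) (EvFibre.ofLoop_comp_toLoop b)⟩

end Based

/-! ### Self-maps of the square -/

namespace Square

/-- The convex combination of two points of the interval. -/
def lin (u a c : I) : I :=
  ⟨(1 - u) * a + u * c, by
    obtain ⟨⟨u0, u1⟩, ⟨a0, a1⟩, ⟨c0, c1⟩⟩ := And.intro u.2 (And.intro a.2 c.2)
    constructor <;> nlinarith⟩

@[fun_prop]
theorem continuous_lin {P : Type*} [TopologicalSpace P] {u a c : P → I} (hu : Continuous u)
    (ha : Continuous a) (hc : Continuous c) : Continuous fun q => lin (u q) (a q) (c q) := by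
  unfold lin
  fun_prop

@[simp] theorem lin_zero (a c : I) : lin 0 a c = a := Subtype.ext (by simp [lin])

@[simp] theorem lin_one (a c : I) : lin 1 a c = c := Subtype.ext (by simp [lin])

@[simp] theorem lin_self (u a : I) : lin u a a = a := Subtype.ext (by simp [lin]; ring)

/-- The straight line homotopy from a self-map of the square to the identity. -/
def contract (χ : C(I × I, I × I)) (u : I) (x : I × I) : I × I :=
  (lin u (χ x).1 x.1, lin u (χ x).2 x.2)

@[fun_prop]
theorem continuous_contract {P : Type*} [TopologicalSpace P] (χ : C(I × I, I × I)) {u : P → I}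
    {x : P → I × I} (hu : Continuous u) (hx : Continuous x) :
    Continuous fun q => contract χ (u q) (x q) := by
  unfold contract
  fun_prop

@[simp] theorem contract_zero (χ : C(I × I, I × I)) (x : I × I) : contract χ 0 x = χ x := by
  simp [contract]

@[simp] theorem contract_one (χ : C(I × I, I × I)) (x : I × I) : contract χ 1 x = x := by
  simp [contract]

theorem contract_eq {χ : C(I × I, I × I)} {x : I × I} (hx : χ x = x) (u : I) :
    contract χ u x = x := by
  simp [contract, hx]

/-- Half of a point of the interval. -/
def half (r : I) : I := ⟨r / 2, by have := r.2; constructor <;> linarith [this.1, this.2]⟩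

/-- The point `1 / 2 + r / 2` of the interval. -/
def half' (r : I) : I := ⟨1 / 2 + r / 2, by have := r.2; constructor <;> linarith [this.1, this.2]⟩

theorem eq_half_or_half' (s : I) : (∃ r, s = half r) ∨ ∃ r, s = half' r := by
  obtain ⟨h0, h1⟩ := s.2
  rcases le_total (s : ℝ) (1 / 2) with h | h
  · exact .inl ⟨⟨2 * s, by linarith, by linarith⟩, Subtype.ext (by simp [half])⟩
  · exact .inr ⟨⟨2 * s - 1, by linarith, by linarith⟩, Subtype.ext (by simp [half']; ring)⟩

/-- A self-map of the square that wraps the left edge around the left edge and the left half of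
the top edge. -/
def wrap : C(I × I, I × I) where
  toFun x :=
    -- Only the boundary values matter. At `x.1 = 0` this climbs the left edge at double speed and
    -- then moves along the top to its midpoint; at `x.2 = 1` it runs through the right half of the
    -- top.
    (⟨x.1 + (1 - x.1) * max 0 ((x.2 : ℝ) - 1 / 2), by
      obtain ⟨⟨a0, a1⟩, ⟨c0, c1⟩⟩ := And.intro x.1.2 x.2.2
      have h0 : (0 : ℝ) ≤ max 0 ((x.2 : ℝ) - 1 / 2) := le_max_left _ _
      have h1 : max 0 ((x.2 : ℝ) - 1 / 2) ≤ 1 := max_le (by norm_num) (by linarith)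
      constructor <;> nlinarith⟩,
    ⟨min 1 ((2 - x.1) * x.2), by
      obtain ⟨⟨a0, a1⟩, ⟨c0, c1⟩⟩ := And.intro x.1.2 x.2.2
      exact ⟨le_min (by norm_num) (mul_nonneg (by linarith) c0), min_le_left _ _⟩⟩)
  continuous_toFun := by fun_prop

/-- A self-map of the square that is inverse to `wrap` on the boundary. -/
def unwrap : C(I × I, I × I) where
  toFun x :=
    (⟨max 0 ((1 + x.2) * x.1 - x.2), by
      obtain ⟨⟨a0, a1⟩, ⟨c0, c1⟩⟩ := And.intro x.1.2 x.2.2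
      exact ⟨le_max_left _ _, max_le (by norm_num) (by nlinarith)⟩⟩,
    ⟨x.2 * min 1 (1 / 2 + (x.1 : ℝ)), by
      obtain ⟨⟨a0, a1⟩, ⟨c0, c1⟩⟩ := And.intro x.1.2 x.2.2
      have h0 : (0 : ℝ) ≤ min 1 (1 / 2 + (x.1 : ℝ)) := le_min (by norm_num) (by linarith)
      have h1 : min 1 (1 / 2 + (x.1 : ℝ)) ≤ 1 := min_le_left _ _
      constructor <;> nlinarith⟩)
  continuous_toFun := by fun_prop

theorem pair_ext {x y : I × I} (h₁ : (x.1 : ℝ) = y.1) (h₂ : (x.2 : ℝ) = y.2) : x = y :=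
  Prod.ext (Subtype.ext h₁) (Subtype.ext h₂)

/-! ### Boundary values of the self-maps of the square -/

theorem wrap_bottom (t : I) : wrap (t, 0) = (t, 0) :=
  pair_ext (by simp [wrap]) (by simp [wrap])

theorem wrap_right (s : I) : wrap (1, s) = (1, s) :=
  pair_ext (by simp [wrap]) (by
    change min 1 ((2 - (1 : ℝ)) * s) = s
    rw [min_eq_right (by linarith [s.2.2])]; ring)

theorem wrap_top (t : I) : wrap (t, 1) = (half' t, 1) := by
  obtain ⟨h0, h1⟩ := t.2
  refine pair_ext ?_ ?_
  · change (t : ℝ) + (1 - t) * max 0 (1 - 1 / 2) = 1 / 2 + t / 2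
    norm_num; ring
  · change min 1 ((2 - (t : ℝ)) * 1) = 1
    rw [min_eq_left (by linarith)]

theorem wrap_left_half (r : I) : wrap (0, half r) = (0, r) := by
  obtain ⟨h0, h1⟩ := r.2
  refine pair_ext ?_ ?_
  · change (0 : ℝ) + (1 - 0) * max 0 ((r : ℝ) / 2 - 1 / 2) = 0
    rw [max_eq_left (by linarith)]; ring
  · change min 1 ((2 - (0 : ℝ)) * (r / 2)) = r
    rw [min_eq_right (by linarith)]; ring

theorem wrap_left_half' (r : I) : wrap (0, half' r) = (half r, 1) := by
  obtain ⟨h0, h1⟩ := r.2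
  refine pair_ext ?_ ?_
  · change (0 : ℝ) + (1 - 0) * max 0 (1 / 2 + (r : ℝ) / 2 - 1 / 2) = r / 2
    rw [max_eq_right (by linarith)]; ring
  · change min 1 ((2 - (0 : ℝ)) * (1 / 2 + r / 2)) = 1
    rw [min_eq_left (by linarith)]

theorem unwrap_bottom (c : I) : unwrap (c, 0) = (c, 0) :=
  pair_ext (by simp [unwrap, c.2.1]) (by simp [unwrap])

theorem unwrap_right (r : I) : unwrap (1, r) = (1, r) :=
  pair_ext (by simp [unwrap]) (by
    change (r : ℝ) * min 1 (1 / 2 + 1) = r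
    norm_num)

theorem unwrap_left (r : I) : unwrap (0, r) = (0, half r) := by
  refine pair_ext ?_ ?_
  · simp [unwrap, r.2.1]
  · change (r : ℝ) * min 1 (1 / 2 + 0) = r / 2
    norm_num
    ring

theorem unwrap_top_half (c : I) : unwrap (half c, 1) = (0, half' c) := by
  obtain ⟨h0, h1⟩ := c.2
  refine pair_ext ?_ ?_
  · change max 0 ((1 + (1 : ℝ)) * (c / 2) - 1) = 0
    rw [max_eq_left (by linarith)]
  · change (1 : ℝ) * min 1 (1 / 2 + (c : ℝ) / 2) = 1 / 2 + c / 2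
    rw [min_eq_right (by linarith), one_mul]

theorem unwrap_top_half' (c : I) : unwrap (half' c, 1) = (c, 1) := by
  obtain ⟨h0, h1⟩ := c.2
  refine pair_ext ?_ ?_
  · change max 0 ((1 + (1 : ℝ)) * (1 / 2 + c / 2) - 1) = c
    rw [max_eq_right (by linarith)]; ring
  · change (1 : ℝ) * min 1 (1 / 2 + (1 / 2 + (c : ℝ) / 2)) = 1
    rw [min_eq_left (by linarith), one_mul]

/-- A self-map of the square that is the identity on the boundary. -/
structure FixesBoundary (χ : C(I × I, I × I)) : Prop where
  bottom (t : I) : χ (t, 0) = (t, 0)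
  top (t : I) : χ (t, 1) = (t, 1)
  left (s : I) : χ (0, s) = (0, s)
  right (s : I) : χ (1, s) = (1, s)

/-- The composites need not be the identity inside. All conditions on the squares concern the
boundary, where `contract` is then stationary, so every stage of it again gives an admissible
square. -/
theorem fixesBoundary_unwrap_comp_wrap : FixesBoundary (unwrap.comp wrap) where
  bottom t := by rw [comp_apply, wrap_bottom, unwrap_bottom]
  top t := by rw [comp_apply, wrap_top, unwrap_top_half']
  left s := by
    rcases eq_half_or_half' s with ⟨r, rfl⟩ | ⟨r, rfl⟩
    · rw [comp_apply, wrap_left_half, unwrap_left]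
    · rw [comp_apply, wrap_left_half', unwrap_top_half]
  right s := by rw [comp_apply, wrap_right, unwrap_right]

theorem fixesBoundary_wrap_comp_unwrap : FixesBoundary (wrap.comp unwrap) where
  bottom c := by rw [comp_apply, unwrap_bottom, wrap_bottom]
  top c := by
    rcases eq_half_or_half' c with ⟨r, rfl⟩ | ⟨r, rfl⟩
    · rw [comp_apply, unwrap_top_half, wrap_left_half']
    · rw [comp_apply, unwrap_top_half', wrap_top]
  left r := by rw [comp_apply, unwrap_left, wrap_left_half]
  right r := by rw [comp_apply, unwrap_right, wrap_right]

end Square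

section Squares

variable {E B P : Type*} [TopologicalSpace E] [TopologicalSpace B] [TopologicalSpace P]

/-! ### Incidence correspondence and fixpoint triples as spaces of squares -/

namespace Incidence

variable {p : C(E, B)} {b : B}

/-- The loop in `E` of a point of the incidence correspondence, as a closed path. -/
def edge (w : Incidence p b) (c : I) : E := FreeLoop.circ (snd _ _ w) c

/-- The path of free loops in `B` of a point of the incidence correspondence, as a square. -/
def cyl (w : Incidence p b) (x : I × I) : B := FreeLoop.circ (line w (1 - x.2)) x.1

@[fun_prop]
theorem continuous_edge {u : P → Incidence p b} {c : P → I} (hu : Continuous u)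
    (hc : Continuous c) : Continuous fun q => edge (u q) (c q) := by
  unfold edge
  fun_prop

@[fun_prop]
theorem continuous_cyl {u : P → Incidence p b} {x : P → I × I} (hu : Continuous u)
    (hx : Continuous x) : Continuous fun q => cyl (u q) (x q) := by
  unfold cyl
  fun_prop

theorem edge_zero (w : Incidence p b) : edge w 0 = edge w 1 :=
  (FreeLoop.circ_of_nonpos _ le_rfl).trans (FreeLoop.circ_of_one_le _ le_rfl).symm

/-- The path of free loops is traversed backwards in `cyl`, so that the loop from `E` lies at the
bottom, as it does for `Triple.square`. -/
theorem cyl_bottom (w : Incidence p b) (c : I) : cyl w (c, 0) = p (edge w c) := by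
  change FreeLoop.circ (line w (1 - 0)) c = _
  rw [sub_zero, line_one, FreeLoop.circ_map]
  rfl

theorem cyl_top (w : Incidence p b) (c : I) : cyl w (c, 1) = (toLoop p b w).extend (2 * c) := by
  change FreeLoop.circ (line w (1 - 1)) c = _
  rw [sub_self, line_zero, FreeLoop.circ_loopIncl]
  rfl

theorem cyl_left (w : Incidence p b) (r : I) : cyl w (0, r) = cyl w (1, r) :=
  (FreeLoop.circ_of_nonpos _ le_rfl).trans (FreeLoop.circ_of_one_le _ le_rfl).symm

theorem ext_cyl {w w' : Incidence p b} (h₁ : toLoop p b w = toLoop p b w')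
    (h₂ : ∀ c, edge w c = edge w' c) (h₃ : ∀ x, cyl w x = cyl w' x) : w = w' := by
  refine HPullback.ext h₁ (FreeLoop.ext_circ h₂) fun r => FreeLoop.ext_circ fun c => ?_
  have := h₃ (c, σ r)
  unfold cyl at this
  simp only [unitInterval.coe_symm_eq, sub_sub_cancel] at this
  rwa [line_coe, line_coe] at this

/-! ### Points of the incidence correspondence from squares -/

section OfCyl

variable (γ : C(P, LoopSpace B b)) (e : C(P × I, E)) (Q : C(P × (I × I), B))
  (he : ∀ q, e (q, 0) = e (q, 1)) (h_bottom : ∀ q c, Q (q, c, 0) = p (e (q, c)))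
  (h_top : ∀ q (c : I), Q (q, c, 1) = (γ q).extend (2 * c))
  (h_left : ∀ q r, Q (q, 0, r) = Q (q, 1, r))

/-- The projection of the line to the unit interval. -/
abbrev toI (r : ℝ) : I := Set.projIcc 0 1 zero_le_one r

/-- The free loops in a family of squares. -/
def cylLoops : C(P × ℝ, FreeLoop B) :=
  FreeLoop.ofCirc (fun q c => Q (q.1, toI c, toI (1 - q.2))) (by fun_prop)
    (fun q => by simpa using h_left q.1 _)

/-- The free loops given by a family of edges. -/
def edgeLoops : C(P, FreeLoop E) :=
  FreeLoop.ofCirc (fun q c => e (q, toI c)) (by fun_prop) (fun q => by simpa using he q)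

theorem circ_cylLoops (q : P) (r : ℝ) (c : I) :
    FreeLoop.circ (cylLoops Q h_left (q, r)) c = Q (q, c, toI (1 - r)) := by
  unfold cylLoops
  rw [FreeLoop.circ_ofCirc _ _ _ _ c.2]
  simp

theorem circ_edgeLoops (q : P) (c : I) : FreeLoop.circ (edgeLoops e he q) c = e (q, c) := by
  unfold edgeLoops
  rw [FreeLoop.circ_ofCirc _ _ _ _ c.2]
  simp

/-- A family of points of the incidence correspondence, given by a family of squares. -/
def ofCyl : C(P, Incidence p b) :=
  HPullback.ofLine γ (edgeLoops e he) (fun q r => cylLoops Q h_left (q, r))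
    (cylLoops Q h_left).continuous
    (fun q => FreeLoop.ext_circ fun c => by
      rw [circ_cylLoops, FreeLoop.circ_loopIncl]
      simpa using h_top q c)
    (fun q => FreeLoop.ext_circ fun c => by
      rw [circ_cylLoops, FreeLoop.circ_map, circ_edgeLoops]
      simpa using h_bottom q c)

theorem edge_ofCyl (q : P) (c : I) :
    edge (ofCyl γ e Q he h_bottom h_top h_left q) c = e (q, c) :=
  circ_edgeLoops e he q c

theorem cyl_ofCyl (q : P) (x : I × I) :
    cyl (ofCyl γ e Q he h_bottom h_top h_left q) x = Q (q, x) := by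
  unfold cyl ofCyl
  rw [line_ofLine _ _ _ _ _ _ _ ⟨by linarith [x.2.2.2], by linarith [x.2.2.1]⟩,
    circ_cylLoops, sub_sub_cancel]
  simp

end OfCyl

end Incidence

/-- The space of triples `(x, γ, π)`. -/
abbrev Triple (p : C(E, B)) (b : B) : Type _ :=
  PathsBetween (act p b) (ContinuousMap.fst : C(Fibre p b × LoopSpace B b, Fibre p b))

namespace Triple

variable {p : C(E, B)} {b : B}

/-- The loop `γ` of a triple `(x, γ, π)`. -/
abbrev loop (z : Triple p b) : LoopSpace B b := (PathsBetween.pt _ _ z).2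

/-- The path in `E` of a triple `(x, γ, π)`. -/
def edge (z : Triple p b) (t : I) : E := Fibre.incl p b (PathsBetween.line z t)

/-- The path of paths in `B` of a triple `(x, γ, π)`. -/
def square (z : Triple p b) (x : I × I) : B := line (PathsBetween.line z x.1) x.2

@[fun_prop]
theorem continuous_edge {u : P → Triple p b} {c : P → I} (hu : Continuous u)
    (hc : Continuous c) : Continuous fun q => edge (u q) (c q) := by
  unfold edge
  fun_prop

@[fun_prop]
theorem continuous_square {u : P → Triple p b} {x : P → I × I} (hu : Continuous u)
    (hx : Continuous x) : Continuous fun q => square (u q) (x q) := by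
  unfold square
  fun_prop

theorem line_zero (z : Triple p b) : PathsBetween.line z (0 : I) = act p b (PathsBetween.pt _ _ z) :=
  PathsBetween.line_of_nonpos z le_rfl

theorem line_one (z : Triple p b) : PathsBetween.line z (1 : I) = (PathsBetween.pt _ _ z).1 :=
  PathsBetween.line_of_one_le z le_rfl

/-- The action changes only the path in `B`, so `x.γ` and `x` have the same point of `E`. -/
theorem edge_zero (z : Triple p b) : edge z 0 = edge z 1 := by
  unfold edge
  rw [line_zero, line_one]
  rfl

theorem square_bottom (z : Triple p b) (t : I) : square z (t, 0) = p (edge z t) :=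
  HPullback.line_zero _

theorem square_top (z : Triple p b) (t : I) : square z (t, 1) = b :=
  HPullback.line_one _

theorem square_left_half (z : Triple p b) (r : I) :
    square z (0, Square.half r) = square z (1, r) := by
  unfold square
  simp only [line_zero, line_one]
  rw [act_line_of_le _ (by change (r : ℝ) / 2 ≤ _; linarith [r.2.2])]
  congr 1
  change 2 * ((r : ℝ) / 2) = r
  ring

theorem square_left_half' (z : Triple p b) (r : I) :
    square z (0, Square.half' r) = loop z r := by
  unfold square
  simp only [line_zero]
  rw [act_line_of_ge _ (by change _ ≤ 1 / 2 + (r : ℝ) / 2; linarith [r.2.1]), ← extend_coe]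
  congr 1
  change 2 * (1 / 2 + (r : ℝ) / 2) - 1 = r
  ring

theorem ext_square {z z' : Triple p b} (h₁ : loop z = loop z')
    (h₂ : ∀ t, edge z t = edge z' t) (h₃ : ∀ x, square z x = square z' x) : z = z' := by
  have key (t : I) : PathsBetween.line z t = PathsBetween.line z' t := by
    refine HPullback.ext (h₂ t) rfl fun s => ?_
    have := h₃ (t, s)
    unfold square at this
    simpa only [line_coe] using this
  refine PathsBetween.ext (Prod.ext ?_ h₁) fun r => ?_
  · have := key 1
    rwa [line_one, line_one] at this
  · have := key r
    rwa [PathsBetween.line_coe, PathsBetween.line_coe] at this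

/-! ### Triples from squares -/

section OfSquare

variable (γ : C(P, LoopSpace B b)) (e : C(P × I, E)) (Q : C(P × (I × I), B))
  (he : ∀ q, e (q, 0) = e (q, 1)) (h_bottom : ∀ q t, Q (q, t, 0) = p (e (q, t)))
  (h_top : ∀ q t, Q (q, t, 1) = b)
  (h_left : ∀ q r, Q (q, 0, Square.half r) = Q (q, 1, r))
  (h_left' : ∀ q r, Q (q, 0, Square.half' r) = γ q r)

/-- The family of points of the fibre in a family of squares. -/
def fibres : C(P × I, Fibre p b) :=
  HPullback.ofLine e (ContinuousMap.const _ ()) (fun q s => Q (q.1, q.2, Incidence.toI s))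
    (by fun_prop) (fun q => by simpa using h_bottom q.1 q.2) (fun q => by simpa using h_top q.1 q.2)

theorem line_fibres (q : P) (t s : I) :
    line (fibres e Q h_bottom h_top (q, t)) s = Q (q, t, s) := by
  unfold fibres
  rw [HPullback.line_ofLine _ _ _ _ _ _ _ s.2]
  simp

theorem fibres_zero (he : ∀ q, e (q, 0) = e (q, 1))
    (h_left : ∀ q r, Q (q, 0, Square.half r) = Q (q, 1, r))
    (h_left' : ∀ q r, Q (q, 0, Square.half' r) = γ q r) (q : P) : fibres e Q h_bottom h_top (q, 0) =
    act p b (fibres e Q h_bottom h_top (q, 1), γ q) := by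
  refine HPullback.ext (he q) rfl fun s => ?_
  rw [← line_coe, ← line_coe, line_fibres]
  rcases Square.eq_half_or_half' s with ⟨r, rfl⟩ | ⟨r, rfl⟩
  · rw [act_line_of_le _ (by change (r : ℝ) / 2 ≤ _; linarith [r.2.2]), h_left,
      ← line_fibres e Q h_bottom h_top]
    congr 1
    change (r : ℝ) = 2 * ((r : ℝ) / 2)
    ring
  · rw [act_line_of_ge _ (by change _ ≤ 1 / 2 + (r : ℝ) / 2; linarith [r.2.1]), h_left',
      ← extend_coe]
    congr 1
    change (r : ℝ) = 2 * (1 / 2 + (r : ℝ) / 2) - 1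
    ring

/-- A family of triples, given by a family of squares. -/
def ofSquare : C(P, Triple p b) :=
  PathsBetween.ofLine
    (ContinuousMap.prodMk ⟨fun q => fibres e Q h_bottom h_top (q, 1), by fun_prop⟩ γ)
    (fun q t => fibres e Q h_bottom h_top (q, Incidence.toI t)) (by fun_prop)
    (fun q => by simpa using fibres_zero γ e Q h_bottom h_top he h_left h_left' q)
    (fun q => by simp)

theorem edge_ofSquare (q : P) (t : I) :
    edge (ofSquare γ e Q he h_bottom h_top h_left h_left' q) t = e (q, t) := by
  unfold edge ofSquare
  rw [PathsBetween.line_ofLine _ _ _ _ _ _ t.2]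
  simp
  rfl

theorem square_ofSquare (q : P) (x : I × I) :
    square (ofSquare γ e Q he h_bottom h_top h_left h_left' q) x = Q (q, x) := by
  unfold square ofSquare
  rw [PathsBetween.line_ofLine _ _ _ _ _ _ x.1.2, line_fibres]
  simp

end OfSquare

end Triple

end Squares

/-! ### The incidence correspondence as a space of triples -/

section Main

variable {E B : Type*} [TopologicalSpace E] [TopologicalSpace B] (p : C(E, B)) (b : B)

/-- The loop of a triple, as a continuous map. -/
def Triple.loopMap : C(Triple p b, LoopSpace B b) :=
  ContinuousMap.snd.comp (PathsBetween.pt _ _)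

/-- The triple of a point of the incidence correspondence. -/
def Incidence.toTriple : C(Incidence p b, Triple p b) :=
  Triple.ofSquare (Incidence.toLoop p b) ⟨fun q => Incidence.edge q.1 q.2, by fun_prop⟩
    ⟨fun q => Incidence.cyl q.1 (Square.wrap q.2), by fun_prop⟩
    Incidence.edge_zero
    (fun w t => by
      change Incidence.cyl w (Square.wrap (t, 0)) = _
      rw [Square.wrap_bottom]
      exact Incidence.cyl_bottom w t)
    (fun w t => by
      change Incidence.cyl w (Square.wrap (t, 1)) = _
      rw [Square.wrap_top, Incidence.cyl_top, Path.extend_of_one_le]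
      change 1 ≤ 2 * (1 / 2 + (t : ℝ) / 2)
      linarith [t.2.1])
    (fun w r => by
      change Incidence.cyl w (Square.wrap _) = Incidence.cyl w (Square.wrap _)
      rw [Square.wrap_left_half, Square.wrap_right, Incidence.cyl_left])
    (fun w r => by
      change Incidence.cyl w (Square.wrap _) = _
      rw [Square.wrap_left_half', Incidence.cyl_top, ← extend_coe]
      congr 1
      change 2 * ((r : ℝ) / 2) = r
      ring)

/-- The point of the incidence correspondence of a triple. -/
def Triple.toIncidence : C(Triple p b, Incidence p b) :=
  Incidence.ofCyl (Triple.loopMap p b) ⟨fun q => Triple.edge q.1 q.2, by fun_prop⟩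
    ⟨fun q => Triple.square q.1 (Square.unwrap q.2), by fun_prop⟩
    Triple.edge_zero
    (fun z t => by
      change Triple.square z (Square.unwrap (t, 0)) = _
      rw [Square.unwrap_bottom]
      exact Triple.square_bottom z t)
    (fun z c => by
      change Triple.square z (Square.unwrap (c, 1)) = _
      rcases Square.eq_half_or_half' c with ⟨r, rfl⟩ | ⟨r, rfl⟩
      · rw [Square.unwrap_top_half, Triple.square_left_half', ← extend_coe]
        change (Triple.loop z).extend (r : ℝ) = (Triple.loop z).extend (2 * ((r : ℝ) / 2))
        congr 1
        ring
      · rw [Square.unwrap_top_half', Triple.square_top, Path.extend_of_one_le]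
        change 1 ≤ 2 * (1 / 2 + (r : ℝ) / 2)
        linarith [r.2.1])
    (fun z r => by
      change Triple.square z (Square.unwrap _) = Triple.square z (Square.unwrap _)
      rw [Square.unwrap_left, Square.unwrap_right, Triple.square_left_half])

variable {p b}

theorem Incidence.edge_toTriple (w : Incidence p b) (t : I) :
    Triple.edge (toTriple p b w) t = edge w t :=
  Triple.edge_ofSquare ..

theorem Incidence.square_toTriple (w : Incidence p b) (x : I × I) :
    Triple.square (toTriple p b w) x = cyl w (Square.wrap x) :=
  Triple.square_ofSquare ..

theorem Triple.edge_toIncidence (z : Triple p b) (t : I) :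
    Incidence.edge (toIncidence p b z) t = edge z t :=
  Incidence.edge_ofCyl ..

theorem Triple.cyl_toIncidence (z : Triple p b) (x : I × I) :
    Incidence.cyl (toIncidence p b z) x = square z (Square.unwrap x) :=
  Incidence.cyl_ofCyl ..

variable (p b)

/-- The straight line homotopies of squares, on triples. -/
def Triple.contract {χ : C(I × I, I × I)} (hχ : Square.FixesBoundary χ) :
    C(I × Triple p b, Triple p b) :=
  Triple.ofSquare ((Triple.loopMap p b).comp ContinuousMap.snd)
    ⟨fun q => Triple.edge q.1.2 q.2, by fun_prop⟩
    ⟨fun q => Triple.square q.1.2 (Square.contract χ q.1.1 q.2), by fun_prop⟩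
    (fun q => Triple.edge_zero q.2)
    (fun q t => by
      change Triple.square q.2 (Square.contract χ q.1 _) = _
      rw [Square.contract_eq (hχ.bottom t)]
      exact Triple.square_bottom q.2 t)
    (fun q t => by
      change Triple.square q.2 (Square.contract χ q.1 _) = _
      rw [Square.contract_eq (hχ.top t), Triple.square_top])
    (fun q r => by
      change Triple.square q.2 (Square.contract χ q.1 _) =
        Triple.square q.2 (Square.contract χ q.1 _)
      rw [Square.contract_eq (hχ.left _), Square.contract_eq (hχ.right _),
        Triple.square_left_half])
    (fun q r => by
      change Triple.square q.2 (Square.contract χ q.1 _) = _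
      rw [Square.contract_eq (hχ.left _), Triple.square_left_half']
      rfl)

/-- The straight line homotopies of squares, on the incidence correspondence. -/
def Incidence.contract {χ : C(I × I, I × I)} (hχ : Square.FixesBoundary χ) :
    C(I × Incidence p b, Incidence p b) :=
  Incidence.ofCyl ((Incidence.toLoop p b).comp ContinuousMap.snd)
    ⟨fun q => Incidence.edge q.1.2 q.2, by fun_prop⟩
    ⟨fun q => Incidence.cyl q.1.2 (Square.contract χ q.1.1 q.2), by fun_prop⟩
    (fun q => Incidence.edge_zero q.2)
    (fun q t => by
      change Incidence.cyl q.2 (Square.contract χ q.1 _) = _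
      rw [Square.contract_eq (hχ.bottom t)]
      exact Incidence.cyl_bottom q.2 t)
    (fun q t => by
      change Incidence.cyl q.2 (Square.contract χ q.1 _) = _
      rw [Square.contract_eq (hχ.top t), Incidence.cyl_top]
      rfl)
    (fun q r => by
      change Incidence.cyl q.2 (Square.contract χ q.1 _) =
        Incidence.cyl q.2 (Square.contract χ q.1 _)
      rw [Square.contract_eq (hχ.left _), Square.contract_eq (hχ.right _), Incidence.cyl_left])

/-- The homotopy from `Triple.toIncidence ∘ Incidence.toTriple` to the identity. -/
def Incidence.toIncidenceToTriple :
    ContinuousMap.Homotopy ((Triple.toIncidence p b).comp (Incidence.toTriple p b))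
      (ContinuousMap.id _) where
  toContinuousMap := Incidence.contract p b Square.fixesBoundary_wrap_comp_unwrap
  map_zero_left w := by
    refine Incidence.ext_cyl rfl (fun c => ?_) fun x => ?_
    · refine (Incidence.edge_ofCyl ..).trans ?_
      rw [comp_apply, Triple.edge_toIncidence, Incidence.edge_toTriple]
      rfl
    · refine (Incidence.cyl_ofCyl ..).trans ?_
      rw [comp_apply, Triple.cyl_toIncidence, Incidence.square_toTriple]
      change Incidence.cyl w (Square.contract _ 0 x) = _
      rw [Square.contract_zero]
      rfl
  map_one_left w := by
    refine Incidence.ext_cyl rfl (fun c => ?_) fun x => ?_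
    · exact Incidence.edge_ofCyl ..
    · refine (Incidence.cyl_ofCyl ..).trans ?_
      change Incidence.cyl w (Square.contract _ 1 x) = _
      rw [Square.contract_one]
      rfl

/-- The homotopy from `Incidence.toTriple ∘ Triple.toIncidence` to the identity. -/
def Triple.toTripleToIncidence :
    ContinuousMap.Homotopy ((Incidence.toTriple p b).comp (Triple.toIncidence p b))
      (ContinuousMap.id _) where
  toContinuousMap := Triple.contract p b Square.fixesBoundary_unwrap_comp_wrap
  map_zero_left z := by
    refine Triple.ext_square rfl (fun c => ?_) fun x => ?_
    · refine (Triple.edge_ofSquare ..).trans ?_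
      rw [comp_apply, Incidence.edge_toTriple, Triple.edge_toIncidence]
      rfl
    · refine (Triple.square_ofSquare ..).trans ?_
      rw [comp_apply, Incidence.square_toTriple, Triple.cyl_toIncidence]
      change Triple.square z (Square.contract _ 0 x) = _
      rw [Square.contract_zero]
      rfl
  map_one_left z := by
    refine Triple.ext_square rfl (fun c => ?_) fun x => ?_
    · exact Triple.edge_ofSquare ..
    · refine (Triple.square_ofSquare ..).trans ?_
      change Triple.square z (Square.contract _ 1 x) = _
      rw [Square.contract_one]
      rfl

theorem isHomotopyEquiv_toTriple : IsHomotopyEquiv (Incidence.toTriple p b) :=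
  isHomotopyEquiv_of (Triple.toIncidence p b) ⟨Incidence.toIncidenceToTriple p b⟩
    ⟨Triple.toTripleToIncidence p b⟩

/-- The equality is strict because `wrap` is the identity on the right edge, which carries the path
of `x`. It allows later comparisons to be equalities of maps. -/
theorem pt_toTriple (w : Incidence p b) :
    PathsBetween.pt _ _ (Incidence.toTriple p b w) = Incidence.toFibreLoop p b w := by
  refine Prod.ext (HPullback.ext ?_ rfl fun s => ?_) rfl
  · exact FreeLoop.circ_of_one_le _ le_rfl
  · have h : HPullback.path (PathsBetween.pt _ _ (Incidence.toTriple p b w)).1 s =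
        Triple.square (Incidence.toTriple p b w) (1, s) := by
      rw [← line_coe]
      unfold Triple.square
      rw [Triple.line_one]
    refine h.trans ?_
    rw [Incidence.square_toTriple, Square.wrap_right]
    refine (FreeLoop.circ_of_one_le _ le_rfl).trans ?_
    change _ = FreeLoop.ev B (HPullback.path w (σ s))
    rw [← line_coe]
    rfl

/-! ### The incidence correspondence as a homotopy pullback -/

/-- The homotopy given by the paths in the triples. -/
def incidenceHomotopy :
    ContinuousMap.Homotopy ((diag (Fibre p b)).comp (Incidence.toFibre p b))
      ((shear p b).comp (Incidence.toFibreLoop p b)) where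
  toFun q := (Incidence.toFibre p b q.2,
    -- The homotopy goes from `(x, x)` to `(x, x.γ)`, hence against the direction of `π`.
    PathsBetween.line (Incidence.toTriple p b q.2) (1 - q.1))
  continuous_toFun := by fun_prop
  map_zero_left w := by
    refine Prod.ext rfl ((PathsBetween.line_of_one_le _ (by simp)).trans ?_)
    exact congrArg Prod.fst (pt_toTriple p b w)
  map_one_left w := by
    refine Prod.ext rfl ((PathsBetween.line_of_nonpos _ (by simp)).trans ?_)
    exact congrArg (act p b) (pt_toTriple p b w)

theorem isHomotopyPullback_incidence :
    IsHomotopyPullback (Incidence.toFibre p b) (Incidence.toFibreLoop p b)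
      (diag (Fibre p b)) (shear p b) := by
  refine ⟨incidenceHomotopy p b, ?_⟩
  -- The homotopy was chosen so that the comparison map factors on the nose through the space of
  -- triples.
  have h : HPullback.lift _ _ (incidenceHomotopy p b) =
      (PathsBetween.toHPullback (act p b) ContinuousMap.fst).comp (Incidence.toTriple p b) := by
    refine ContinuousMap.ext fun w => HPullback.ext ?_ ?_ fun t => Prod.ext ?_ rfl
    · exact (congrArg Prod.fst (pt_toTriple p b w)).symm
    · exact (pt_toTriple p b w).symm
    · exact (congrArg Prod.fst (pt_toTriple p b w)).symm
  rw [h]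
  exact (PathsBetween.isHomotopyEquiv_toHPullback _ _).comp (isHomotopyEquiv_toTriple p b)

/-! ### Fibres of the incidence correspondence -/

/-- The map of homotopy fibres over `γ` induced by `Incidence.toTriple`. -/
def FixSpace.toParamFibre (γ : LoopSpace B b) :
    C(FixSpace p b γ, PathsBetween.ParamFibre (act p b) (ContinuousMap.id _) γ) :=
  HPullback.map (f := ContinuousMap.const Unit γ) (g := Incidence.toLoop p b)
    (f' := ContinuousMap.const Unit γ) (g' := PathsBetween.param (act p b) (ContinuousMap.id _))
    (ContinuousMap.id Unit) (Incidence.toTriple p b) (ContinuousMap.id _) rfl rfl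

/-- The map from `F^γ` to the space of homotopy fixpoints of `γ`. -/
def FixSpace.toSlice (γ : LoopSpace B b) :
    C(FixSpace p b γ, PathsBetween (PathsBetween.slice (act p b) γ) (ContinuousMap.id _)) :=
  (PathsBetween.toSlice (act p b) (ContinuousMap.id _) γ).comp (FixSpace.toParamFibre p b γ)

/-- Both maps and both homotopies move only squares and keep the loop, so each compatibility over
`ΩB` holds by definition. -/
theorem FixSpace.isHomotopyEquiv_toParamFibre (γ : LoopSpace B b) :
    IsHomotopyEquiv (FixSpace.toParamFibre p b γ) :=
  isHomotopyEquiv_map_of_over (ContinuousMap.const Unit γ) (g := Incidence.toLoop p b)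
    (h := PathsBetween.param (act p b) (ContinuousMap.id _)) (φ := Incidence.toTriple p b)
    (ψ := Triple.toIncidence p b) rfl
    (Incidence.toIncidenceToTriple p b) (fun _ => rfl)
    (Triple.toTripleToIncidence p b) (fun _ => rfl)

theorem FixSpace.isHomotopyEquiv_toSlice (γ : LoopSpace B b) :
    IsHomotopyEquiv (FixSpace.toSlice p b γ) :=
  (PathsBetween.isHomotopyEquiv_toSlice _ _ _).comp (isHomotopyEquiv_toParamFibre p b γ)

/-- Including a strict fibre after dragging is homotopic to the projection from the homotopy fibre,
and that projection commutes with `Incidence.toTriple` by definition. -/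
theorem FixSpace.ofSlice_comp_toSlice (γ : LoopSpace B b) :
    ((PathsBetween.ofSlice (act p b) (ContinuousMap.id _) γ).comp
      (FixSpace.toSlice p b γ)).Homotopic
        ((Incidence.toTriple p b).comp (FixSpace.toIncidence p b γ)) :=
  (PathsBetween.ofSlice_comp_toSlice (act p b) (ContinuousMap.id _) γ).comp
    (ContinuousMap.Homotopic.refl (FixSpace.toParamFibre p b γ))

end Main

end FixInt

end

open FixInt
theorem mainTheorem3 {E B : Type*} [TopologicalSpace E] [TopologicalSpace B]
    [PathConnectedSpace B] (p : C(E, B)) (b : B) :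
    -- the based loop space is the fibre of the free loop space
    IsHomotopyPullback (loopIncl b) (ContinuousMap.const (LoopSpace B b) ())
      (FreeLoop.ev B) (ContinuousMap.const Unit b) ∧
    -- `F ×_E F ≃ F × ΩB`, and the two projections become the shear map
    (IsHomotopyEquiv (FibreProd.toFibreLoop p b) ∧
      ((shear p b).comp (FibreProd.toFibreLoop p b)).Homotopic (FibreProd.projections p b)) ∧
    -- the incidence correspondence is the pullback of the shear map along the diagonal
    IsHomotopyPullback (Incidence.toFibre p b) (Incidence.toFibreLoop p b)
      (diag (Fibre p b)) (shear p b) ∧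
    -- it is the space of triples `(x, γ, π)`, and its fibre over `γ` is the space of pairs `(x, π)`
    ∃ Ψ : C(Incidence p b, FixTriple p b), IsHomotopyEquiv Ψ ∧
      ((FixTriple.toFibreLoop p b).comp Ψ).Homotopic (Incidence.toFibreLoop p b) ∧
      ∀ γ : LoopSpace B b, ∃ Θ : C(FixSpace p b γ, FixPair p b γ), IsHomotopyEquiv Θ ∧
        ((FixPair.toFixTriple p b γ).comp Θ).Homotopic
          (Ψ.comp (FixSpace.toIncidence p b γ)) := by
  -- `FixTriple` and `FixPair` unfold to the spaces `PathsBetween` for `act` and for its slice at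
  -- `γ`, so the maps constructed for those serve as `Ψ` and `Θ`.
  refine ⟨isHomotopyPullback_loopIncl b,
    ⟨FibreProd.isHomotopyEquiv_toFibreLoop p b, FibreProd.shear_comp_toFibreLoop p b⟩,
    isHomotopyPullback_incidence p b, Incidence.toTriple p b, isHomotopyEquiv_toTriple p b, ?_,
    fun γ => ⟨FixSpace.toSlice p b γ, FixSpace.isHomotopyEquiv_toSlice p b γ, ?_⟩⟩
  · rw [show (FixTriple.toFibreLoop p b).comp (Incidence.toTriple p b) =
      Incidence.toFibreLoop p b from ContinuousMap.ext (pt_toTriple p b)]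
  -- The two inclusions differ only in that `ofSlice` passes through the extension of `π` to the
  -- line.
  · have h : FixPair.toFixTriple p b γ =
        PathsBetween.ofSlice (act p b) (ContinuousMap.id _) γ :=
      ContinuousMap.ext fun t => Subtype.ext (Prod.ext rfl (ContinuousMap.ext fun r =>
        (PathsBetween.line_coe (u := PathsBetween.slice (act p b) γ)
          (v := ContinuousMap.id _) t r).symm))
    rw [h]
    exact FixSpace.ofSlice_comp_toSlice p b γ
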